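/- **Setting.** Let $H$ be a separable real Hilbert space and $A:D(A)\subset H\to H$ a self-adjoint operator with $\langle Ax,x\rangle\ge\delta|x|^2$ for all $x\in D(A)$ and some $\delta>0$, such that $A^{-1}$ is of trace class. Let $(e_j)_j$ be a (countable) orthonormal basis of $H$ with $e_j\in D(A)$ and $Ae_j=\alpha_je_j$, $\alpha_j\in\mathbb R$, and let $\mu$ be the Gaussian measure on $H$ with mean zero and covariance operator $\frac12A^{-1}$. Let $C_b^1(H)$ be the set of bounded Fréchet differentiable functions $H\to\mathbb R$ with bounded derivative $D$, and for $K\subset H$ let $C_b^1(K)$ be the set of restrictions to $K$ of functions in $C_b^1(H)$; for $u\in C_b^1(K)$, $Du$ is computed from any extension, and $\partial_iu=\langle Du,e_i\rangle$. Let $D^*$ be the adjoint of $D:C_b^1(H)\subset L^2(H;\mu)\to L^2(H,H;\mu)$, and let $(C_b^1)_{D(A)}$ be the set of fields $G=\sum_{j=1}^m g_j\,l^j$ with $g_j\in C_b^1(H)$, $l^j\in D(A)$. For a Borel function $\rho$ put $V(\rho)=\sup\{\int_H D^*G\,\rho\,d\mu : G\in(C_b^1)_{D(A)},\ |G|\le1\}$.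 We say $\rho\in BV(H,H)$ if $\int_H A_{1/2}(|\rho|)\,d\mu<\infty$, where $A_{1/2}(x)=\int_0^x(\log(1+s))^{1/2}ds$, and $V(\rho)<\infty$. Let $\Gamma\subset H$ be closed, convex and bounded with $\mathbb I_\Gamma\in BV(H,H)$. Let $\breve A:\Gamma\to L(H,H)$ take values in the bounded linear operators, and let $\breve a_{ij}(z)=\langle e_i,\breve A(z)e_j\rangle$. Assume 1. $\sup_{z\in\Gamma}\sum_{i,j}|\breve a_{ij}(z)|^2<\infty$; 2. $\breve a_{ij}=-\breve a_{ji}$ on $\Gamma$ for all $i,j$; 3. $\breve a_{ij}\in C_b^1(\Gamma)$ for all $i,j$; 4. with $\beta^\mu_{e_i}(z)=-2\langle Ae_i,z\rangle$, $$\mu\text{-}\operatorname*{ess\,sup}_{z\in\Gamma}\ \sum_j\Big(\sum_i\Big|\frac{\breve a_{ij}(z)}2\beta^\mu_{e_i}(z)+\frac{\partial_i\breve a_{ij}(z)}2\Big|\Big)^2<\infty .$$ Set $\beta^{\mu,\breve A}=\sum_j\Big(\sum_i\big(\frac{\breve a_{ij}}2\beta^\mu_{e_i}+\frac{\partial_i\breve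 a_{ij}}2\big)\Big)e_j$, $\ \bar A=\breve A+\mathrm{Id}$, $\ \bar A^*=\breve A^*+\mathrm{Id}$ (the transposed matrix, i.e. the adjoint operator, at each point), and $$\mathcal E^{\Gamma,\bar A}(u,v)=\frac12\int_\Gamma\langle\bar A(Du),Dv\rangle\,d\mu,\qquad u,v\in C_b^1(\Gamma).$$ A pair $(\|\partial\Gamma\|,\eta_\Gamma)$ is called the surface measure and exterior normal of $\Gamma$ if $\|\partial\Gamma\|$ is a finite positive Borel measure supported by $\partial\Gamma$ with $\|\partial\Gamma\|(\Gamma)=V(\mathbb I_\Gamma)$, $\eta_\Gamma:H\to H$ is Borel measurable with $|\eta_\Gamma|=1$ $\|\partial\Gamma\|$-a.e., and $$\int_\Gamma D^*G\,d\mu=-\int_{\partial\Gamma}\langle G,\eta_\Gamma\rangle\,d\|\partial\Gamma\|\qquad\text{for all }G\in(C_b^1)_{D(A)}.$$ Write $\nu_\Gamma=-\eta_\Gamma$ for the inward normal. **Proposition.** Such a pair $(\|\partial\Gamma\|,\eta_\Gamma)$ exists, and for any such pair, every $l\in D(A)$ and every $g\in C_b^1(H)$, the function $l(\cdot)=\langle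 l,\cdot\rangle$ belongs to $C_b^1(\Gamma)$, all integrals below are absolutely convergent, and $$-\mathcal E^{\Gamma,\bar A}(l(\cdot),g)=\int_\Gamma g\,\langle l,\beta^{\mu,\breve A}\rangle\,d\mu-\int_\Gamma g(z)\,\langle Al,z\rangle\,\mu(dz)+\frac12\int_{\partial\Gamma}g\,\langle l,\bar A^*\nu_\Gamma\rangle\,d\|\partial\Gamma\| .$$ -/

import Mathlib

open MeasureTheory ProbabilityTheory Set Topology
open scoped ENNReal InnerProductSpace

noncomputable section

section Operators

variable {H : Type*} [NormedAddCommGroup H] [InnerProductSpace ℝ H]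

/-- `B` is the (everywhere defined, bounded) inverse of the unbounded operator `A`. -/
def IsBoundedInverse (A : H →ₗ.[ℝ] H) (B : H →L[ℝ] H) : Prop :=
  (∀ x : H, ∃ h : B x ∈ A.domain, A ⟨B x, h⟩ = x) ∧ ∀ x : A.domain, B (A x) = (x : H)

/-- A bounded operator on a Hilbert space is of trace class (equivalently, nuclear): it is an
absolutely convergent series of rank-one operators. -/
def IsTraceClass (T : H →L[ℝ] H) : Prop :=
  ∃ x y : ℕ → H, Summable (fun n => ‖x n‖ * ‖y n‖) ∧
    ∀ h : H, HasSum (fun n => ⟪x n, h⟫_ℝ • y n) (T h)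

/-- `μ` is the Gaussian measure with mean zero and covariance operator `Q`. -/
structure IsCenteredGaussian [MeasurableSpace H] [BorelSpace H]
    (μ : Measure H) (Q : H →L[ℝ] H) : Prop where
  isGaussian : IsGaussian μ
  mean_zero : ∫ z, z ∂μ = 0
  covariance : ∀ x y : H, ∫ z, ⟪x, z⟫_ℝ * ⟪y, z⟫_ℝ ∂μ = ⟪Q x, y⟫_ℝ

/-- The Hilbert–Schmidt (Frobenius) norm of an operator, possibly infinite. -/
def frobeniusNorm {ι : Type*} (e : HilbertBasis ι ℝ H) (B : H →L[ℝ] H) : ℝ≥0∞ :=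
  (∑' i, ∑' j, ‖⟪e i, B (e j)⟫_ℝ‖ₑ ^ 2) ^ (1 / 2 : ℝ)

end Operators

section Cb1

variable {H : Type*} [NormedAddCommGroup H] [InnerProductSpace ℝ H]

/-- `C_b^1(H)`: bounded Fréchet differentiable functions with bounded Fréchet derivative. -/
def IsCb1 (f : H → ℝ) : Prop :=
  Differentiable ℝ f ∧ (∃ C : ℝ, ∀ z, |f z| ≤ C) ∧ ∃ C : ℝ, ∀ z, ‖fderiv ℝ f z‖ ≤ C

/-- `C_b^1(K)`: the restriction of `f` to `K` is the restriction of some function in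
`C_b^1(H)`. Only the values of `f` on `K` matter. -/
def IsCb1On (K : Set H) (f : H → ℝ) : Prop :=
  ∃ g : H → ℝ, IsCb1 g ∧ EqOn f g K

open Classical in
/-- The gradient `Df` on `K` of a function `f ∈ C_b^1(K)`, computed from an extension of `f|_K`
in `C_b^1(H)`. For `K` closed and convex the restriction to `K` does not depend on the
extension, up to null sets of a nondegenerate Gaussian measure. -/
def gradOn [CompleteSpace H] (K : Set H) (f : H → ℝ) : H → H :=
  if h : IsCb1On K f then gradient h.choose else 0

end Cb1

section BV

variable {H : Type*} [NormedAddCommGroup H] [InnerProductSpace ℝ H] [CompleteSpace H]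
  [MeasurableSpace H] [BorelSpace H]

/-- `w ∈ L²(H; μ)` is the value `D^* G` of the adjoint of the gradient
`D : C_b^1(H) ⊂ L²(H; μ) → L²(H, H; μ)`. -/
def IsGradAdjoint (μ : Measure H) (G : H → H) (w : H → ℝ) : Prop :=
  MemLp w 2 μ ∧ ∀ f : H → ℝ, IsCb1 f → ∫ z, w z * f z ∂μ = ∫ z, ⟪G z, gradient f z⟫_ℝ ∂μ

open Classical in
/-- (A version of) `D^* G`, for `G` in the domain of `D^*`. -/
def gradAdjoint (μ : Measure H) (G : H → H) : H → ℝ :=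
  if h : ∃ w : H → ℝ, IsGradAdjoint μ G w then h.choose else 0

/-- The family `(C_b^1)_{D(A)}` of vector fields `G = ∑ g_j l_j` (finite sum) with
`g_j ∈ C_b^1(H)` and `l_j ∈ D(A)`. -/
def IsTestField (A : H →ₗ.[ℝ] H) (G : H → H) : Prop :=
  ∃ (m : ℕ) (g : Fin m → H → ℝ) (l : Fin m → A.domain),
    (∀ j, IsCb1 (g j)) ∧ ∀ z, G z = ∑ j, g j z • (l j : H)

/-- The Young function `A_{1/2}(x) = ∫_0^x (log (1 + s))^{1/2} ds`. -/
def youngHalf (x : ℝ) : ℝ := ∫ s in (0 : ℝ)..x, Real.sqrt (Real.log (1 + s))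

/-- `f ∈ L (log L)^{1/2}(H, μ)`. -/
def MemLLogLHalf (μ : Measure H) (f : H → ℝ) : Prop :=
  Measurable f ∧ Integrable (fun z => youngHalf |f z|) μ

/-- The total variation `V(ρ)`: the supremum of `∫ (D^* G) ρ dμ` over `G ∈ (C_b^1)_{D(A)}` with
`|G| ≤ 1`. As `G = 0` is admitted the supremum is nonnegative, so it is taken in `[0, ∞]`. -/
def totalVar (A : H →ₗ.[ℝ] H) (μ : Measure H) (ρ : H → ℝ) : ℝ≥0∞ :=
  ⨆ (G : H → H) (_ : IsTestField A G) (_ : ∀ z, ‖G z‖ ≤ 1),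
    ENNReal.ofReal (∫ z, gradAdjoint μ G z * ρ z ∂μ)

/-- `ρ ∈ BV(H, H)`. -/
def IsBV (A : H →ₗ.[ℝ] H) (μ : Measure H) (ρ : H → ℝ) : Prop :=
  MemLLogLHalf μ ρ ∧ totalVar A μ ρ < ∞

/-- The indicator function of `Γ`. -/
def ind (Γ : Set H) : H → ℝ := Γ.indicator 1

/-- `σ` is the surface measure `‖∂Γ‖` and `η` the exterior normal `η_Γ` of `Γ`: the polar
decomposition of the vector measure which is the distributional derivative of the indicator
function of `Γ`. -/
structure IsSurfacePair (A : H →ₗ.[ℝ] H) (μ : Measure H) (Γ : Set H)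
    (σ : Measure H) (η : H → H) : Prop where
  finite : IsFiniteMeasure σ
  support : σ (frontier Γ)ᶜ = 0
  measurable : Measurable η
  norm_eq_one : ∀ᵐ z ∂σ, ‖η z‖ = 1
  mass : σ Γ = totalVar A μ (ind Γ)
  gauss : ∀ G : H → H, IsTestField A G →
    ∫ z in Γ, gradAdjoint μ G z ∂μ = - ∫ z in frontier Γ, ⟪G z, η z⟫_ℝ ∂σ

end BV

section Oblique

variable {H : Type*} [NormedAddCommGroup H] [InnerProductSpace ℝ H] [CompleteSpace H]
  {ι : Type*}

/-- The matrix entry `a_{ij}(z)`, where `B(z) e_j = ∑_i a_{ij}(z) e_i`. -/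
def entry (e : HilbertBasis ι ℝ H) (B : H → H →L[ℝ] H) (i j : ι) (z : H) : ℝ :=
  ⟪e i, B z (e j)⟫_ℝ

/-- The logarithmic derivative `β^μ_{e_i}(z) = -2 ⟨A e_i, z⟩`. -/
def logDerivGauss (A : H →ₗ.[ℝ] H) (e : HilbertBasis ι ℝ H) (he : ∀ i, e i ∈ A.domain)
    (i : ι) (z : H) : ℝ :=
  -2 * ⟪A ⟨e i, he i⟩, z⟫_ℝ

/-- The summand `a_{ij} β^μ_{e_i} / 2 + ∂_i a_{ij} / 2`. -/
def driftTerm (A : H →ₗ.[ℝ] H) (e : HilbertBasis ι ℝ H) (he : ∀ i, e i ∈ A.domain)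
    (Γ : Set H) (B : H → H →L[ℝ] H) (i j : ι) (z : H) : ℝ :=
  entry e B i j z / 2 * logDerivGauss A e he i z + ⟪gradOn Γ (entry e B i j) z, e i⟫_ℝ / 2

/-- The drift `β^{μ, B} = ∑_j (∑_i (a_{ij} β^μ_{e_i} / 2 + ∂_i a_{ij} / 2)) e_j`. -/
def drift (A : H →ₗ.[ℝ] H) (e : HilbertBasis ι ℝ H) (he : ∀ i, e i ∈ A.domain)
    (Γ : Set H) (B : H → H →L[ℝ] H) (z : H) : H :=
  ∑' j, (∑' i, driftTerm A e he Γ B i j z) • e j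

/-- The bilinear form `𝓔^{Γ, B}(u, v) = (1/2) ∫_Γ ⟨B(Du), Dv⟩ dμ` on `C_b^1(Γ)`. -/
def form [MeasurableSpace H] (μ : Measure H) (Γ : Set H) (B : H → H →L[ℝ] H)
    (u v : H → ℝ) : ℝ :=
  1 / 2 * ∫ z in Γ, ⟪B z (gradOn Γ u z), gradOn Γ v z⟫_ℝ ∂μ

end Oblique

end

set_option linter.unusedSectionVars false

open Filter

/-! ### Calculus of $C_b^1$ functions and smooth cut-offs. -/

section Cb1Calculus

variable {H : Type*} [NormedAddCommGroup H] [InnerProductSpace ℝ H]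

/-! Everything rests on Gaussian integration by parts along one direction $l\in D(A)$. Write
$z=tl+y$ with $t=\langle Al,z\rangle/\langle Al,l\rangle$. Since $\mu$ has covariance
$\frac12A^{-1}$, $t$ and $y$ are uncorrelated, hence independent, and $t$ is a centered Gaussian
(`exists_isSlicing`). On each line, $D^*(g\,l)=2\langle Al,\cdot\rangle g-\langle Dg,l\rangle$ times
the density of $t$ is an exact derivative. Integrating over whole lines identifies $D^*$.
Integrating over $\Gamma$, whose line sections are compact intervals, leaves only endpoint terms, so
the derivative of $\mathbb I_\Gamma$ along $l$ is a difference of two finite measures on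
$\partial\Gamma$ (`IsSlicing.exists_boundary_measures`).

Existence of the surface pair: the derivatives along the $e_i$ have densities $h_i$ with respect to
one finite measure $m$ on $\partial\Gamma$. Testing with fields $\sum_{i\in s}G_ie_i$ of length at
most one, and using density of $C_b^1$ in $L^1$, gives $\int(\sum_ih_i^2)^{1/2}dm\le V(\mathbb
I_\Gamma)<\infty$ (`lintegral_tsum_le_totalVar`). Hence the $h_i$ are the coordinates of an
$m$-integrable field $X$, and $\|\partial\Gamma\|=|X|\,m$, $\eta_\Gamma=-X/|X|$. Expanding in the
eigenbasis carries the Gauss formula from the $e_i$ to all of $D(A)$.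

The formula: for any surface pair, the Gauss formula for the field $g\,l$ handles the identity part
of $\bar A$. For $\breve A$ it is applied to each field $\breve a_{ij}g\,e_i$, multiplied by
$\langle l,e_j\rangle$ and summed over $(i,j)$ (`IsSurfacePair.integral_matrix`). The
Hilbert–Schmidt bound and the drift bound make the double series absolutely convergent, uniformly
almost everywhere, so sums and integrals commute. Gradients on $\Gamma$ are independent of the
extension almost everywhere because line sections are points, which are null, or intervals with
interior (`gradOn_ae_eq`). -/

theorem isCb1_const (c : ℝ) : IsCb1 (fun _ : H => c) :=
  ⟨differentiable_const c, ⟨|c|, fun _ => le_rfl⟩, ⟨0, fun z => by simp⟩⟩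

theorem IsCb1.add {f g : H → ℝ} (hf : IsCb1 f) (hg : IsCb1 g) : IsCb1 (fun z => f z + g z) := by
  obtain ⟨df, ⟨C, hC⟩, D, hD⟩ := hf
  obtain ⟨dg, ⟨C', hC'⟩, D', hD'⟩ := hg
  refine ⟨df.add dg, ⟨C + C', fun z => (abs_add_le _ _).trans (add_le_add (hC z) (hC' z))⟩,
    D + D', fun z => ?_⟩
  rw [fderiv_fun_add (df z) (dg z)]
  exact (norm_add_le _ _).trans (add_le_add (hD z) (hD' z))

theorem IsCb1.mul {f g : H → ℝ} (hf : IsCb1 f) (hg : IsCb1 g) : IsCb1 (fun z => f z * g z) := by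
  obtain ⟨df, ⟨C, hC⟩, D, hD⟩ := hf
  obtain ⟨dg, ⟨C', hC'⟩, D', hD'⟩ := hg
  have hC0 : 0 ≤ C := (abs_nonneg _).trans (hC 0)
  have hC0' : 0 ≤ C' := (abs_nonneg _).trans (hC' 0)
  refine ⟨df.mul dg, ⟨C * C', fun z => ?_⟩, C * D' + C' * D, fun z => ?_⟩
  · rw [abs_mul]
    exact mul_le_mul (hC z) (hC' z) (abs_nonneg _) hC0
  · rw [fderiv_fun_mul (df z) (dg z)]
    refine (norm_add_le _ _).trans (add_le_add ?_ ?_)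
    · rw [norm_smul]
      exact mul_le_mul (hC z) (hD' z) (norm_nonneg _) hC0
    · rw [norm_smul]
      exact mul_le_mul (hC' z) (hD z) (norm_nonneg _) hC0'

theorem IsCb1.const_mul {f : H → ℝ} (hf : IsCb1 f) (c : ℝ) : IsCb1 (fun z => c * f z) :=
  (isCb1_const c).mul hf

theorem IsCb1.neg {f : H → ℝ} (hf : IsCb1 f) : IsCb1 (fun z => - f z) := by
  simpa using hf.const_mul (-1)

theorem IsCb1.sub {f g : H → ℝ} (hf : IsCb1 f) (hg : IsCb1 g) : IsCb1 (fun z => f z - g z) := by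
  simpa [sub_eq_add_neg] using hf.add hg.neg

theorem IsCb1.sum {ι : Type*} (s : Finset ι) {f : ι → H → ℝ} (hf : ∀ i, IsCb1 (f i)) :
    IsCb1 (fun z => ∑ i ∈ s, f i z) := by
  classical
  induction s using Finset.induction_on with
  | empty => simpa using isCb1_const (H := H) 0
  | insert i s hi ih => simpa [Finset.sum_insert hi] using (hf i).add ih

/-- The bounds on `φ` and `φ'` are asked only on the range of `f`, so that functions singular
elsewhere, such as negative powers, are admitted. -/
theorem IsCb1.comp {f : H → ℝ} (hf : IsCb1 f) {φ φ' : ℝ → ℝ} {C : ℝ}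
    (hφ : ∀ z, HasDerivAt φ (φ' (f z)) (f z)) (hb : ∀ z, |φ (f z)| ≤ C)
    (hb' : ∀ z, |φ' (f z)| ≤ C) : IsCb1 (fun z => φ (f z)) := by
  obtain ⟨df, -, D, hD⟩ := hf
  have key : ∀ z, HasFDerivAt (fun z => φ (f z)) (φ' (f z) • fderiv ℝ f z) z := fun z =>
    (hφ z).comp_hasFDerivAt z (df z).hasFDerivAt
  refine ⟨fun z => (key z).differentiableAt, ⟨C, hb⟩, C * D, fun z => ?_⟩
  rw [(key z).fderiv, norm_smul]
  exact mul_le_mul (hb' z) (hD z) (norm_nonneg _) ((abs_nonneg _).trans (hb' 0))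

theorem IsCb1.inv_sqrt {f : H → ℝ} (hf : IsCb1 f) (h0 : ∀ z, 0 ≤ f z) {ε : ℝ} (hε : 0 < ε) :
    IsCb1 (fun z => (ε + f z) ^ (-(1 / 2) : ℝ)) := by
  refine hf.comp (φ := fun s => (ε + s) ^ (-(1 / 2) : ℝ))
    (φ' := fun s => 1 * (-(1 / 2) : ℝ) * (ε + s) ^ (-(1 / 2) - 1 : ℝ))
    (C := ε ^ (-(1 / 2) : ℝ) + ε ^ (-(1 / 2) - 1 : ℝ)) (fun z => ?_) (fun z => ?_) (fun z => ?_)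
  · have hpos : ε + f z ≠ 0 := by linarith [h0 z]
    exact ((hasDerivAt_id (f z)).const_add ε).rpow_const (Or.inl hpos)
  · have hpos : 0 ≤ ε + f z := by linarith [h0 z]
    rw [abs_of_nonneg (Real.rpow_nonneg hpos _)]
    have := Real.rpow_le_rpow_of_nonpos hε (by linarith [h0 z] : ε ≤ ε + f z)
      (by norm_num : (-(1 / 2) : ℝ) ≤ 0)
    have := Real.rpow_nonneg hε.le (-(1 / 2) - 1 : ℝ)
    linarith
  · have hpos : 0 ≤ ε + f z := by linarith [h0 z]
    rw [abs_mul, abs_of_nonneg (Real.rpow_nonneg hpos _)]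
    have h1 := Real.rpow_le_rpow_of_nonpos hε (by linarith [h0 z] : ε ≤ ε + f z)
      (by norm_num : (-(1 / 2) - 1 : ℝ) ≤ 0)
    have h2 := Real.rpow_nonneg hε.le (-(1 / 2) : ℝ)
    have h3 := Real.rpow_nonneg hpos (-(1 / 2) - 1 : ℝ)
    have h4 : |1 * (-(1 / 2) : ℝ)| = 1 / 2 := by norm_num [abs_div]
    rw [h4]
    linarith

theorem deriv_smoothTransition_of_neg {t : ℝ} (ht : t < 0) : deriv Real.smoothTransition t = 0 := by
  have : Real.smoothTransition =ᶠ[𝓝 t] fun _ => (0 : ℝ) := by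
    filter_upwards [gt_mem_nhds ht] with s hs using Real.smoothTransition.zero_of_nonpos (le_of_lt hs)
  rw [this.deriv_eq, deriv_const]

theorem exists_bound_deriv_smoothTransition : ∃ M : ℝ, ∀ t, |deriv Real.smoothTransition t| ≤ M := by
  have hc : Continuous (deriv Real.smoothTransition) :=
    (Real.smoothTransition.contDiff (n := 1)).continuous_deriv le_rfl
  obtain ⟨M, hM⟩ := isCompact_Icc.exists_bound_of_continuousOn (s := Icc (0 : ℝ) 1) hc.continuousOn
  have hM0 : 0 ≤ M := (norm_nonneg _).trans (hM 0 (by simp))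
  refine ⟨M, fun t => ?_⟩
  rcases lt_or_ge t 0 with h | h
  · simpa [deriv_smoothTransition_of_neg h] using hM0
  rcases lt_or_ge 1 t with h' | h'
  · have : Real.smoothTransition =ᶠ[𝓝 t] fun _ => (1 : ℝ) := by
      filter_upwards [lt_mem_nhds h'] with s hs using Real.smoothTransition.one_of_one_le (le_of_lt hs)
    simpa [this.deriv_eq] using hM0
  · exact hM t ⟨h, h'⟩

/-- Multiplying by a smooth cut-off function of a ball turns a locally bounded differentiable
function into an element of `C_b^1(H)`. -/
theorem isCb1_cutoff_mul {f : H → ℝ} (hf : Differentiable ℝ f) {x : H} {r C : ℝ} (n : ℝ)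
    (hr : 0 ≤ r) (hC : ∀ z, ‖z - x‖ ≤ r → |f z| ≤ C) (hC' : ∀ z, ‖z - x‖ ≤ r → ‖fderiv ℝ f z‖ ≤ C)
    (hn : 0 < n) :
    IsCb1 (fun z => Real.smoothTransition (n * (r ^ 2 - ‖z - x‖ ^ 2)) * f z) := by
  obtain ⟨M, hM⟩ := exists_bound_deriv_smoothTransition
  have hM0 : 0 ≤ M := (abs_nonneg _).trans (hM 0)
  have hC0 : 0 ≤ C := (abs_nonneg _).trans (hC x (by simpa using hr))
  set s : H → ℝ := fun z => n * (r ^ 2 - ‖z - x‖ ^ 2) with hs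
  -- Off the closed ball the argument is strictly negative, so the cut-off and its derivative both
  -- vanish there; bounds on `f` are needed only in the ball.
  have hsneg : ∀ z, ¬ ‖z - x‖ ≤ r → s z < 0 := by
    intro z hz
    push Not at hz
    have : r ^ 2 < ‖z - x‖ ^ 2 := by nlinarith
    exact mul_neg_of_pos_of_neg hn (by linarith)
  have hds : ∀ z, HasFDerivAt s ((n • -(2 • innerSL ℝ (z - x)) : H →L[ℝ] ℝ)) z := by
    intro z
    have h1 : HasFDerivAt (fun z : H => ‖z - x‖ ^ 2) (2 • innerSL ℝ (z - x)) z := by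
      simpa using ((hasFDerivAt_id z).sub_const x).norm_sq
    simpa using (h1.const_sub (r ^ 2)).const_mul n
  have hdφ : ∀ z, HasFDerivAt (fun z => Real.smoothTransition (s z))
      (deriv Real.smoothTransition (s z) • ((n • -(2 • innerSL ℝ (z - x)) : H →L[ℝ] ℝ))) z := fun z =>
    ((Real.smoothTransition.contDiff (n := 1)).differentiable (by norm_num) (s z)).hasDerivAt.comp_hasFDerivAt
      z (hds z)
  have hd := fun z => (hdφ z).mul (hf z).hasFDerivAt
  refine ⟨fun z => (hd z).differentiableAt, ⟨C, fun z => ?_⟩, C + C * (M * (n * (2 * r))), fun z => ?_⟩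
  · by_cases hz : ‖z - x‖ ≤ r
    · rw [abs_mul, abs_of_nonneg (Real.smoothTransition.nonneg _)]
      calc _ ≤ 1 * C := mul_le_mul (Real.smoothTransition.le_one _) (hC z hz) (abs_nonneg _) zero_le_one
        _ = C := one_mul C
    · change |Real.smoothTransition (s z) * f z| ≤ C
      simpa [Real.smoothTransition.zero_of_nonpos (hsneg z hz).le] using hC0
  · have hfd : fderiv ℝ (fun z => Real.smoothTransition (s z) * f z) z = _ := (hd z).fderiv
    change ‖fderiv ℝ (fun z => Real.smoothTransition (s z) * f z) z‖ ≤ _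
    rw [hfd]
    by_cases hz : ‖z - x‖ ≤ r
    · refine (norm_add_le _ _).trans (add_le_add ?_ ?_)
      · rw [norm_smul, Real.norm_of_nonneg (Real.smoothTransition.nonneg _)]
        calc _ ≤ 1 * C := mul_le_mul (Real.smoothTransition.le_one _) (hC' z hz) (norm_nonneg _) zero_le_one
          _ = C := one_mul C
      · rw [norm_smul, norm_smul]
        refine mul_le_mul (hC z hz) (mul_le_mul (hM _) ?_ (norm_nonneg _) hM0) (by positivity) hC0
        rw [norm_smul, norm_neg, Real.norm_of_nonneg hn.le]
        refine mul_le_mul_of_nonneg_left ?_ hn.le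
        calc ‖2 • innerSL ℝ (z - x)‖ ≤ 2 * ‖innerSL ℝ (z - x)‖ := by
              simpa using norm_nsmul_le (n := 2) (a := innerSL ℝ (z - x))
          _ ≤ 2 * r := by rw [innerSL_apply_norm]; linarith
    · simp only [Real.smoothTransition.zero_of_nonpos (hsneg z hz).le,
        deriv_smoothTransition_of_neg (hsneg z hz), zero_smul, smul_zero, add_zero, norm_zero]
      positivity

theorem IsCb1.continuous {f : H → ℝ} (hf : IsCb1 f) : Continuous f := hf.1.continuous

theorem isCb1On_inner {K : Set H} (hK : Bornology.IsBounded K) (l : H) :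
    ∃ u : H → ℝ, IsCb1 u ∧ EqOn (fun z => ⟪l, z⟫_ℝ) u K := by
  obtain ⟨R, hR⟩ := hK.subset_closedBall 0
  have hfd : ∀ z : H, HasFDerivAt (fun z => ⟪l, z⟫_ℝ) (innerSL ℝ l) z := fun z =>
    (innerSL ℝ l).hasFDerivAt
  have hr0 : 0 ≤ |R| + 1 := by positivity
  refine ⟨_, isCb1_cutoff_mul (f := fun z => ⟪l, z⟫_ℝ) (x := 0) (r := |R| + 1)
    (C := ‖l‖ * (|R| + 1) + ‖l‖) (fun z => (hfd z).differentiableAt) 1 hr0 ?_ ?_ one_pos, ?_⟩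
  · intro z hz
    have := abs_real_inner_le_norm l z
    have h2 : ‖l‖ * ‖z‖ ≤ ‖l‖ * (|R| + 1) :=
      mul_le_mul_of_nonneg_left (by simpa using hz) (norm_nonneg _)
    linarith [norm_nonneg l]
  · intro z _
    rw [(hfd z).fderiv, innerSL_apply_norm]
    nlinarith [norm_nonneg l]
  · intro z hz
    have h1 : ‖z‖ ≤ |R| := (by simpa using hR hz : ‖z‖ ≤ R).trans (le_abs_self R)
    -- The radius $|R|+1$ is chosen so that $(|R|+1)^2-\|z\|^2\ge 1$ on `K`, where the cut-off is
    -- therefore identically one.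
    have h2 : (1 : ℝ) ≤ 1 * ((|R| + 1) ^ 2 - ‖z - 0‖ ^ 2) := by
      simp only [sub_zero]
      nlinarith [norm_nonneg z, abs_nonneg R]
    change _ = Real.smoothTransition (1 * ((|R| + 1) ^ 2 - ‖z - 0‖ ^ 2)) * ⟪l, z⟫_ℝ
    rw [Real.smoothTransition.one_of_one_le h2, one_mul]

end Cb1Calculus

/-! ### Gradients and derivatives along lines. -/

section Gradient

variable {H : Type*} [NormedAddCommGroup H] [InnerProductSpace ℝ H] [CompleteSpace H]

theorem norm_gradient (f : H → ℝ) (z : H) : ‖gradient f z‖ = ‖fderiv ℝ f z‖ := by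
  simp [gradient]

theorem IsCb1.exists_norm_gradient_le {f : H → ℝ} (hf : IsCb1 f) : ∃ C, ∀ z, ‖gradient f z‖ ≤ C := by
  obtain ⟨-, -, C, hC⟩ := hf
  exact ⟨C, fun z => by rw [norm_gradient]; exact hC z⟩

theorem measurable_gradient [MeasurableSpace H] [BorelSpace H] (f : H → ℝ) :
    Measurable (gradient f) := by
  unfold gradient
  exact (InnerProductSpace.toDual ℝ H).symm.continuous.measurable.comp (measurable_fderiv ℝ f)

theorem IsCb1.hasDerivAt_line {f : H → ℝ} (hf : IsCb1 f) (l y : H) (t : ℝ) :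
    HasDerivAt (fun t : ℝ => f (t • l + y)) ⟪gradient f (t • l + y), l⟫_ℝ t := by
  have h1 : HasDerivAt (fun t : ℝ => t • l + y) l t := by
    simpa using ((hasDerivAt_id t).smul_const l).add_const y
  have h2 := (hf.1 (t • l + y)).hasFDerivAt.comp_hasDerivAt t h1
  rwa [inner_gradient_left]

theorem IsCb1.gradient_mul {f g : H → ℝ} (hf : IsCb1 f) (hg : IsCb1 g) (z : H) :
    gradient (fun z => f z * g z) z = f z • gradient g z + g z • gradient f z := by
  simp [gradient, fderiv_fun_mul (hf.1 z) (hg.1 z)]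

end Gradient

/-! ### Density of $C_b^1$ in $L^1$ and duality. -/

section Density

variable {H : Type*} [NormedAddCommGroup H] [InnerProductSpace ℝ H]

theorem isCb1_bump (x : H) {r : ℝ} (hr : 0 ≤ r) {n : ℝ} (hn : 0 < n) :
    IsCb1 (fun z => Real.smoothTransition (n * (r ^ 2 - ‖z - x‖ ^ 2))) := by
  simpa using isCb1_cutoff_mul (f := fun _ : H => (1 : ℝ)) (x := x) (C := 1)
    (differentiable_const 1) n hr (by simp) (by simp) hn

theorem tendsto_bump {H : Type*} [SeminormedAddCommGroup H] (x : H) {r : ℝ} (hr : 0 ≤ r) (z : H) :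
    Tendsto (fun n : ℕ => Real.smoothTransition (((n : ℝ) + 1) * (r ^ 2 - ‖z - x‖ ^ 2))) atTop
      (𝓝 ((Metric.ball x r).indicator 1 z)) := by
  by_cases hz : z ∈ Metric.ball x r
  · rw [indicator_of_mem hz]
    rw [Metric.mem_ball, dist_eq_norm] at hz
    have hpos : 0 < r ^ 2 - ‖z - x‖ ^ 2 := by nlinarith [norm_nonneg (z - x)]
    obtain ⟨N, hN⟩ := exists_nat_ge (1 / (r ^ 2 - ‖z - x‖ ^ 2))
    refine tendsto_const_nhds.congr' ?_
    filter_upwards [eventually_ge_atTop N] with n hn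
    refine (Real.smoothTransition.one_of_one_le ?_).symm
    have h1 : (N : ℝ) ≤ n := by exact_mod_cast hn
    rw [div_le_iff₀ hpos] at hN
    nlinarith
  · rw [indicator_of_notMem hz]
    rw [Metric.mem_ball, dist_eq_norm, not_lt] at hz
    refine tendsto_const_nhds.congr fun n => (Real.smoothTransition.zero_of_nonpos ?_).symm
    have : r ^ 2 ≤ ‖z - x‖ ^ 2 := by nlinarith
    exact mul_nonpos_of_nonneg_of_nonpos (by positivity) (by linarith)

/-- `S` is approximated in `L¹(λ)` by functions of class `C_b^1` with values in `[0, 1]`. -/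
def Cb1Approx [MeasurableSpace H] (m : Measure H) (S : Set H) : Prop :=
  ∀ ε : ℝ≥0∞, ε ≠ 0 → ∃ f : H → ℝ, IsCb1 f ∧ (∀ z, f z ∈ Icc (0 : ℝ) 1) ∧
    ∫⁻ z, ‖f z - S.indicator 1 z‖ₑ ∂m ≤ ε

variable [MeasurableSpace H] [BorelSpace H]

theorem cb1Approx_ball (m : Measure H) [IsFiniteMeasure m] (x : H) (r : ℝ) :
    Cb1Approx m (Metric.ball x r) := by
  intro ε hε
  rcases lt_or_ge r 0 with hr | hr
  · refine ⟨fun _ => 0, isCb1_const 0, by simp, ?_⟩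
    simp [Metric.ball_eq_empty.2 hr.le]
  set F : ℕ → H → ℝ := fun n z => Real.smoothTransition (((n : ℝ) + 1) * (r ^ 2 - ‖z - x‖ ^ 2))
    with hF
  have hFc : ∀ n, IsCb1 (F n) := fun n => isCb1_bump x hr (by positivity)
  have hlim : Tendsto (fun n => ∫⁻ z, ‖F n z - (Metric.ball x r).indicator 1 z‖ₑ ∂m) atTop
      (𝓝 (∫⁻ _, 0 ∂m)) := by
    refine tendsto_lintegral_of_dominated_convergence' (fun _ => 1) (fun n => ?_) (fun n => ?_) ?_ ?_
    · exact ((hFc n).continuous.measurable.sub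
        (measurable_one.indicator Metric.isOpen_ball.measurableSet)).enorm.aemeasurable
    · refine ae_of_all _ fun z => ?_
      have h0 := Real.smoothTransition.nonneg (((n : ℝ) + 1) * (r ^ 2 - ‖z - x‖ ^ 2))
      have h1 := Real.smoothTransition.le_one (((n : ℝ) + 1) * (r ^ 2 - ‖z - x‖ ^ 2))
      change ‖F n z - (Metric.ball x r).indicator 1 z‖ₑ ≤ 1
      rw [← ofReal_norm, Real.norm_eq_abs, ENNReal.ofReal_le_one]
      by_cases hz : z ∈ Metric.ball x r
      · rw [indicator_of_mem hz, abs_le, Pi.one_apply]; constructor <;> linarith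
      · rw [indicator_of_notMem hz, abs_le]; constructor <;> linarith
    · simp
    · refine ae_of_all _ fun z => ?_
      have := ((tendsto_bump x hr z).sub_const ((Metric.ball x r).indicator 1 z)).enorm
      simpa using this
  rw [lintegral_zero] at hlim
  obtain ⟨n, hn⟩ := (hlim.eventually (gt_mem_nhds (pos_iff_ne_zero.2 hε))).exists
  exact ⟨F n, hFc n, fun z => ⟨Real.smoothTransition.nonneg _, Real.smoothTransition.le_one _⟩, hn.le⟩

theorem Cb1Approx.compl {H : Type*} [NormedAddCommGroup H] [InnerProductSpace ℝ H]
    [MeasurableSpace H] {m : Measure H} {S : Set H} (h : Cb1Approx m S) : Cb1Approx m Sᶜ := by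
  intro ε hε
  obtain ⟨f, hf, h01, hfε⟩ := h ε hε
  refine ⟨fun z => 1 - f z, (isCb1_const 1).sub hf, fun z => ?_, ?_⟩
  · obtain ⟨h0, h1⟩ := h01 z
    constructor <;> linarith
  · refine le_trans (le_of_eq (lintegral_congr fun z => ?_)) hfε
    by_cases hz : z ∈ S
    · simp only [indicator_of_mem hz, indicator_of_notMem (notMem_compl_iff.2 hz), Pi.one_apply]
      rw [← enorm_neg]; congr 1; ring
    · simp only [indicator_of_notMem hz, indicator_of_mem (mem_compl hz), Pi.one_apply]
      rw [← enorm_neg]; congr 1; ring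

theorem Cb1Approx.union {m : Measure H} {S T : Set H} (hT' : MeasurableSet T)
    (hS : Cb1Approx m S) (hT : Cb1Approx m T) : Cb1Approx m (S ∪ T) := by
  intro ε hε
  have hε2 : ε / 2 ≠ 0 := (ENNReal.half_pos hε).ne'
  obtain ⟨f, hf, hf01, hfε⟩ := hS _ hε2
  obtain ⟨g, hg, hg01, hgε⟩ := hT _ hε2
  refine ⟨fun z => 1 - (1 - f z) * (1 - g z),
    (isCb1_const 1).sub (((isCb1_const 1).sub hf).mul ((isCb1_const 1).sub hg)), fun z => ?_, ?_⟩
  · obtain ⟨h0, h1⟩ := hf01 z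
    obtain ⟨h0', h1'⟩ := hg01 z
    constructor <;> nlinarith
  · calc ∫⁻ z, ‖1 - (1 - f z) * (1 - g z) - (S ∪ T).indicator 1 z‖ₑ ∂m
        ≤ ∫⁻ z, (‖f z - S.indicator 1 z‖ₑ + ‖g z - T.indicator 1 z‖ₑ) ∂m := by
          refine lintegral_mono fun z => ?_
          rw [← ofReal_norm, ← ofReal_norm, ← ofReal_norm,
            ← ENNReal.ofReal_add (norm_nonneg _) (norm_nonneg _)]
          refine ENNReal.ofReal_le_ofReal ?_
          obtain ⟨h0, h1⟩ := hf01 z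
          obtain ⟨h0', h1'⟩ := hg01 z
          simp only [Real.norm_eq_abs]
          by_cases hzS : z ∈ S <;> by_cases hzT : z ∈ T
          · rw [indicator_of_mem (mem_union_left _ hzS), indicator_of_mem hzS, indicator_of_mem hzT,
              Pi.one_apply, abs_of_nonpos (by nlinarith), abs_of_nonpos (by linarith),
              abs_of_nonpos (by linarith)]
            nlinarith
          · rw [indicator_of_mem (mem_union_left _ hzS), indicator_of_mem hzS,
              indicator_of_notMem hzT, Pi.one_apply, abs_of_nonpos (by nlinarith),
              abs_of_nonpos (by linarith), abs_of_nonneg (by linarith)]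
            nlinarith
          · rw [indicator_of_mem (mem_union_right _ hzT), indicator_of_mem hzT,
              indicator_of_notMem hzS, Pi.one_apply, abs_of_nonpos (by nlinarith),
              abs_of_nonneg (by linarith), abs_of_nonpos (by linarith)]
            nlinarith
          · rw [indicator_of_notMem (by simp [hzS, hzT]), indicator_of_notMem hzS,
              indicator_of_notMem hzT, abs_of_nonneg (by nlinarith), abs_of_nonneg (by linarith),
              abs_of_nonneg (by linarith)]
            nlinarith
      _ = ∫⁻ z, ‖f z - S.indicator 1 z‖ₑ ∂m + ∫⁻ z, ‖g z - T.indicator 1 z‖ₑ ∂m :=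
          lintegral_add_right _ (hg.continuous.measurable.sub
            (measurable_one.indicator hT')).enorm
      _ ≤ ε / 2 + ε / 2 := add_le_add hfε hgε
      _ = ε := ENNReal.add_halves ε

theorem cb1Approx_accumulate {m : Measure H} {S : ℕ → Set H} (hS' : ∀ n, MeasurableSet (S n))
    (hS : ∀ n, Cb1Approx m (S n)) (n : ℕ) : Cb1Approx m (accumulate S n) := by
  induction n with
  | zero => simpa using hS 0
  | succ n ih =>
    rw [accumulate_succ]
    exact ih.union (hS' _) (hS _)

theorem cb1Approx_iUnion {m : Measure H} [IsFiniteMeasure m] {S : ℕ → Set H}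
    (hS' : ∀ n, MeasurableSet (S n)) (hS : ∀ n, Cb1Approx m (S n)) :
    Cb1Approx m (⋃ n, S n) := by
  intro ε hε
  have hε2 : ε / 2 ≠ 0 := (ENNReal.half_pos hε).ne'
  have hacc : ∀ n, MeasurableSet (accumulate S n) := fun n => by
    rw [accumulate_def]; exact MeasurableSet.biUnion (to_countable _) fun i _ => hS' i
  have hlim : Tendsto (fun n => ∫⁻ z, ‖(accumulate S n).indicator (1 : H → ℝ) z
      - (⋃ n, S n).indicator 1 z‖ₑ ∂m) atTop (𝓝 (∫⁻ _, 0 ∂m)) := by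
    refine tendsto_lintegral_of_dominated_convergence' (fun _ => 1) (fun n => ?_) (fun n => ?_) ?_ ?_
    · exact ((measurable_one.indicator (hacc n)).sub
        (measurable_one.indicator (MeasurableSet.iUnion hS'))).enorm.aemeasurable
    · refine ae_of_all _ fun z => ?_
      by_cases h1 : z ∈ accumulate S n <;> by_cases h2 : z ∈ ⋃ n, S n <;>
        simp only [indicator_of_mem, indicator_of_notMem, h1, h2, not_false_eq_true] <;> simp
    · simp
    · refine ae_of_all _ fun z => ?_
      refine tendsto_const_nhds.congr' ?_
      by_cases h2 : z ∈ ⋃ n, S n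
      · obtain ⟨N, hN⟩ := mem_iUnion.1 h2
        filter_upwards [eventually_ge_atTop N] with n hn
        have h1 : z ∈ accumulate S n := mem_accumulate.2 ⟨N, hn, hN⟩
        rw [indicator_of_mem h1, indicator_of_mem h2]; simp
      · refine Eventually.of_forall fun n => ?_
        have h1 : z ∉ accumulate S n := fun h => by
          obtain ⟨k, -, hk⟩ := mem_accumulate.1 h
          exact h2 (mem_iUnion.2 ⟨k, hk⟩)
        simp only [indicator_of_notMem h1, indicator_of_notMem h2]; simp
  rw [lintegral_zero] at hlim
  obtain ⟨n, hn⟩ := (hlim.eventually (gt_mem_nhds (pos_iff_ne_zero.2 hε2))).exists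
  obtain ⟨f, hf, hf01, hfε⟩ := cb1Approx_accumulate hS' hS n (ε / 2) hε2
  refine ⟨f, hf, hf01, ?_⟩
  calc ∫⁻ z, ‖f z - (⋃ n, S n).indicator 1 z‖ₑ ∂m
      ≤ ∫⁻ z, (‖f z - (accumulate S n).indicator 1 z‖ₑ
        + ‖(accumulate S n).indicator (1 : H → ℝ) z - (⋃ n, S n).indicator 1 z‖ₑ) ∂m := by
        refine lintegral_mono fun z => ?_
        refine le_trans (le_of_eq ?_) (enorm_add_le _ _)
        congr 1; ring
    _ = ∫⁻ z, ‖f z - (accumulate S n).indicator 1 z‖ₑ ∂m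
        + ∫⁻ z, ‖(accumulate S n).indicator (1 : H → ℝ) z - (⋃ n, S n).indicator 1 z‖ₑ ∂m :=
        lintegral_add_left (hf.continuous.measurable.sub (measurable_one.indicator (hacc n))).enorm _
    _ ≤ ε / 2 + ε / 2 := add_le_add hfε hn.le
    _ = ε := ENNReal.add_halves ε

/-- By separability the balls generate the Borel sets, and approximability passes from balls to
complements and countable unions. -/
theorem cb1Approx_of_measurableSet [SecondCountableTopology H] (m : Measure H) [IsFiniteMeasure m]
    {S : Set H} (hS : MeasurableSet S) : Cb1Approx m S := by
  have hbasis : TopologicalSpace.IsTopologicalBasis {B : Set H | ∃ x r, B = Metric.ball x r} := by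
    refine TopologicalSpace.isTopologicalBasis_of_isOpen_of_nhds ?_ ?_
    · rintro _ ⟨x, r, rfl⟩; exact Metric.isOpen_ball
    · intro x U hx hU
      obtain ⟨r, hr, h⟩ := Metric.isOpen_iff.1 hU x hx
      exact ⟨_, ⟨x, r, rfl⟩, Metric.mem_ball_self hr, h⟩
  have hgen : ‹MeasurableSpace H› = MeasurableSpace.generateFrom {B : Set H | ∃ x r, B = Metric.ball x r} := by
    rw [← hbasis.borel_eq_generateFrom]; exact BorelSpace.measurable_eq
  have hS' : MeasurableSet[MeasurableSpace.generateFrom {B : Set H | ∃ x r, B = Metric.ball x r}] S := by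
    rwa [← hgen]
  refine MeasurableSpace.generateFrom_induction {B : Set H | ∃ x r, B = Metric.ball x r}
    (fun S _ => Cb1Approx m S) ?_ ?_ ?_ ?_ S hS'
  · rintro _ ⟨x, r, rfl⟩ -
    exact cb1Approx_ball m x r
  · intro ε _
    exact ⟨fun _ => 0, isCb1_const 0, by simp, by simp⟩
  · intro t _ ht
    exact ht.compl
  · intro s hs hs'
    exact cb1Approx_iUnion (fun n => by rw [hgen]; exact hs n) hs'

theorem exists_seq_isCb1_tendsto_ae [SecondCountableTopology H] (m : Measure H) [IsFiniteMeasure m]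
    {h : H → ℝ} (hh : Integrable h m) :
    ∃ f : ℕ → H → ℝ, (∀ n, IsCb1 (f n)) ∧ ∀ᵐ z ∂m, Tendsto (fun n => f n z) atTop (𝓝 (h z)) := by
  have key : ∀ ε : ℝ≥0∞, ε ≠ 0 → ∃ g, eLpNorm (h - g) 1 m ≤ ε ∧ IsCb1 g := by
    intro ε hε
    refine (memLp_one_iff_integrable.2 hh).induction_dense ENNReal.one_ne_top IsCb1 ?_ ?_ ?_ hε
    · intro c s hs _ ε hε
      by_cases hc : c = 0
      · exact ⟨fun _ => 0, by simp [hc], isCb1_const 0⟩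
      have hc' : ‖c‖ₑ ≠ 0 := by simpa using hc
      obtain ⟨f, hf, -, hfε⟩ := cb1Approx_of_measurableSet m hs (ε / ‖c‖ₑ)
        (ENNReal.div_ne_zero.2 ⟨hε, enorm_ne_top⟩)
      refine ⟨fun z => c * f z, ?_, hf.const_mul c⟩
      rw [eLpNorm_one_eq_lintegral_enorm]
      calc ∫⁻ z, ‖((fun z => c * f z) - s.indicator fun _ => c) z‖ₑ ∂m
          = ∫⁻ z, ‖c‖ₑ * ‖f z - s.indicator 1 z‖ₑ ∂m := by
            refine lintegral_congr fun z => ?_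
            rw [← enorm_mul]
            congr 1
            by_cases hz : z ∈ s
            · simp [hz]; ring
            · simp [hz]
        _ = ‖c‖ₑ * ∫⁻ z, ‖f z - s.indicator 1 z‖ₑ ∂m := lintegral_const_mul' _ _ enorm_ne_top
        _ ≤ ‖c‖ₑ * (ε / ‖c‖ₑ) := by gcongr
        _ ≤ ε := ENNReal.mul_div_le
    · intro f g hf hg
      exact hf.add hg
    · intro f hf
      exact hf.continuous.measurable.aestronglyMeasurable
  have hpos : ∀ n : ℕ, ((n : ℝ≥0∞) + 1)⁻¹ ≠ 0 := fun n => by simp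
  choose g hg hg' using fun n : ℕ => key ((n : ℝ≥0∞) + 1)⁻¹ (hpos n)
  have hlim : Tendsto (fun n => eLpNorm (g n - h) 1 m) atTop (𝓝 0) := by
    have h0 : Tendsto (fun n : ℕ => ((n : ℝ≥0∞) + 1)⁻¹) atTop (𝓝 0) := by
      have := (tendsto_add_atTop_iff_nat 1).2 ENNReal.tendsto_inv_nat_nhds_zero
      simpa using this
    refine tendsto_of_tendsto_of_tendsto_of_le_of_le tendsto_const_nhds h0 (fun _ => zero_le) fun n => ?_
    exact (eLpNorm_sub_comm _ _ _ _).trans_le (hg n)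
  obtain ⟨ns, -, hns⟩ := (tendstoInMeasure_of_tendsto_eLpNorm one_ne_zero
    (fun n => (hg' n).continuous.measurable.aestronglyMeasurable) hh.1 hlim).exists_seq_tendsto_ae
  exact ⟨fun n => g (ns n), fun n => hg' _, hns⟩

/-- The `L¹` norm of an integrable field is approached by pairing it with `C_b^1` fields of length
at most one. -/
theorem exists_seq_isCb1_field [SecondCountableTopology H] (m : Measure H) [IsFiniteMeasure m]
    {ι : Type*} (s : Finset ι) {h : ι → H → ℝ} (hh : ∀ i, Integrable (h i) m) :
    ∃ G : ℕ → ι → H → ℝ, (∀ n i, IsCb1 (G n i)) ∧ (∀ n z, ∑ i ∈ s, G n i z ^ 2 ≤ 1) ∧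
      Tendsto (fun n => ∫ z, ∑ i ∈ s, G n i z * h i z ∂m) atTop
        (𝓝 (∫ z, √(∑ i ∈ s, h i z ^ 2) ∂m)) := by
  choose f hf hfl using fun i => exists_seq_isCb1_tendsto_ae m (hh i)
  set S : ℕ → H → ℝ := fun n z => ∑ i ∈ s, f i n z ^ 2 with hSdef
  have hS0 : ∀ n z, 0 ≤ S n z := fun n z => Finset.sum_nonneg fun i _ => sq_nonneg _
  have hSc : ∀ n, IsCb1 (S n) := fun n => IsCb1.sum s fun i => by
    simpa [sq] using (hf i n).mul (hf i n)
  have hε : ∀ n : ℕ, (0 : ℝ) < 1 / ((n : ℝ) + 1) := fun n => by positivity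
  -- A regularized $1/|f_n|$: the positive shift keeps it in $C_b^1$ at zeros of $f_n$ and forces
  -- the normalized field to have length at most one.
  set w : ℕ → H → ℝ := fun n z => (1 / ((n : ℝ) + 1) + S n z) ^ (-(1 / 2) : ℝ) with hw
  have hwsq : ∀ n z, w n z ^ 2 = (1 / ((n : ℝ) + 1) + S n z)⁻¹ := fun n z => by
    have hp : 0 ≤ 1 / ((n : ℝ) + 1) + S n z := add_nonneg (hε n).le (hS0 n z)
    rw [hw]
    simp only
    rw [← Real.rpow_natCast, ← Real.rpow_mul hp]
    norm_num [Real.rpow_neg_one]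
  have hbd : ∀ n z, ∑ i ∈ s, (f i n z * w n z) ^ 2 ≤ 1 := by
    intro n z
    have hp : 0 < 1 / ((n : ℝ) + 1) + S n z := add_pos_of_pos_of_nonneg (hε n) (hS0 n z)
    simp only [mul_pow, hwsq, ← Finset.sum_mul]
    rw [← div_eq_mul_inv, div_le_one hp]
    have := (hε n).le
    change S n z ≤ _
    linarith
  have hG : ∀ n i, IsCb1 (fun z => f i n z * w n z) := fun n i =>
    (hf i n).mul ((hSc n).inv_sqrt (hS0 n) (hε n))
  refine ⟨fun n i z => f i n z * w n z, hG, hbd, ?_⟩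
  have hcs : ∀ n z, |∑ i ∈ s, f i n z * w n z * h i z| ≤ ∑ i ∈ s, |h i z| := by
    intro n z
    refine (Finset.abs_sum_le_sum_abs _ _).trans (Finset.sum_le_sum fun i hi => ?_)
    rw [abs_mul]
    have h1 : (f i n z * w n z) ^ 2 ≤ 1 :=
      (Finset.single_le_sum (f := fun i => (f i n z * w n z) ^ 2) (fun _ _ => sq_nonneg _) hi).trans
        (hbd n z)
    have h2 : |f i n z * w n z| ≤ 1 := (sq_le_one_iff_abs_le_one _).1 h1
    exact mul_le_of_le_one_left (abs_nonneg _) h2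
  refine tendsto_integral_of_dominated_convergence (fun z => ∑ i ∈ s, |h i z|) (fun n => ?_) ?_
    (fun n => ae_of_all _ fun z => hcs n z) ?_
  · exact Finset.aestronglyMeasurable_fun_sum _ fun i _ =>
      (hG n i).continuous.measurable.aestronglyMeasurable.mul (hh i).1
  · exact integrable_finsetSum _ fun i _ => (hh i).abs
  · have hall : ∀ᵐ z ∂m, ∀ i ∈ s, Tendsto (fun n => f i n z) atTop (𝓝 (h i z)) :=
      (Finset.eventually_all s).2 fun i _ => hfl i
    filter_upwards [hall] with z hz
    have hε0 : Tendsto (fun n : ℕ => 1 / ((n : ℝ) + 1)) atTop (𝓝 0) :=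
      tendsto_one_div_add_atTop_nhds_zero_nat
    have hSl : Tendsto (fun n : ℕ => 1 / ((n : ℝ) + 1) + S n z) atTop (𝓝 (∑ i ∈ s, h i z ^ 2)) := by
      simpa using hε0.add (tendsto_finsetSum s fun i hi => (hz i hi).pow 2)
    have hnum : Tendsto (fun n => ∑ i ∈ s, f i n z * h i z) atTop (𝓝 (∑ i ∈ s, h i z ^ 2)) := by
      simpa [sq] using tendsto_finsetSum s fun i hi => (hz i hi).mul_const (h i z)
    have hsum : ∀ n, ∑ i ∈ s, f i n z * w n z * h i z = (∑ i ∈ s, f i n z * h i z) * w n z := fun n => by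
      rw [Finset.sum_mul]; exact Finset.sum_congr rfl fun i _ => by ring
    have hnn : 0 ≤ ∑ i ∈ s, h i z ^ 2 := Finset.sum_nonneg fun i _ => sq_nonneg _
    -- Where all `h i` vanish, `w n` may blow up, but the integrand is then exactly zero; elsewhere
    -- the power is continuous at the positive limit.
    rcases hnn.eq_or_lt with h0 | hpos
    · have hz0 : ∀ i ∈ s, h i z = 0 := fun i hi => by
        have := (Finset.sum_eq_zero_iff_of_nonneg (fun i _ => sq_nonneg (h i z))).1 h0.symm i hi
        simpa using this
      rw [← h0, Real.sqrt_zero]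
      refine tendsto_const_nhds.congr fun n => (Finset.sum_eq_zero fun i hi => ?_).symm
      rw [hz0 i hi, mul_zero]
    · simp only [hsum]
      have hwl : Tendsto (fun n => w n z) atTop (𝓝 ((∑ i ∈ s, h i z ^ 2) ^ (-(1 / 2) : ℝ))) :=
        hSl.rpow_const (Or.inl hpos.ne')
      have hfin := hnum.mul hwl
      have he : (∑ i ∈ s, h i z ^ 2) * (∑ i ∈ s, h i z ^ 2) ^ (-(1 / 2) : ℝ)
          = √(∑ i ∈ s, h i z ^ 2) := by
        rw [Real.sqrt_eq_rpow]
        nth_rewrite 1 [← Real.rpow_one (∑ i ∈ s, h i z ^ 2)]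
        rw [← Real.rpow_add hpos]
        norm_num
      rwa [he] at hfin

/-- A function which is orthogonal to `C_b^1(H)` vanishes almost everywhere. -/
theorem ae_eq_zero_of_integral_mul_isCb1 [SecondCountableTopology H] (m : Measure H)
    [IsFiniteMeasure m] {w : H → ℝ} (hw : Integrable w m)
    (h : ∀ f : H → ℝ, IsCb1 f → ∫ z, w z * f z ∂m = 0) : w =ᵐ[m] 0 := by
  obtain ⟨G, hG, -, hlim⟩ := exists_seq_isCb1_field m (Finset.univ : Finset Unit) (h := fun _ => w)
    (fun _ => hw)
  have h1 : ∫ z, |w z| ∂m = 0 := by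
    have h2 : (fun n => ∫ z, ∑ i : Unit, G n i z * w z ∂m) = fun _ => (0 : ℝ) := by
      funext n
      simpa [mul_comm] using h _ (hG n ())
    rw [h2] at hlim
    simpa [Real.sqrt_sq_eq_abs] using (tendsto_nhds_unique hlim tendsto_const_nhds)
  have h3 := (integral_eq_zero_iff_of_nonneg (fun z => abs_nonneg _) hw.abs).1 h1
  filter_upwards [h3] with z hz using by simpa using hz

end Density

/-! ### One-dimensional Gaussian integration by parts. -/

section GaussianDensity

open Real in
theorem hasDerivAt_gaussianPDFReal_zero (v : NNReal) (t : ℝ) :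
    HasDerivAt (gaussianPDFReal 0 v) (-(t / v) * gaussianPDFReal 0 v t) t := by
  have h1 : HasDerivAt (fun x : ℝ => -(x - 0) ^ 2 / (2 * v)) (-(t / v)) t := by
    refine ((((hasDerivAt_id' t).sub_const 0).fun_pow 2).fun_neg.div_const (2 * (v : ℝ))).congr_deriv ?_
    by_cases hv : (v : ℝ) = 0
    · simp [hv]
    · field_simp
      simp
      ring
  have h2 := h1.exp.const_mul (√(2 * π * v))⁻¹
  rw [gaussianPDFReal_def]
  exact h2.congr_deriv (by ring)

theorem integrable_div_mul_gaussianPDFReal {v : NNReal} (hv : v ≠ 0) :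
    Integrable (fun t : ℝ => t / v * gaussianPDFReal 0 v t) := by
  have h1 : Integrable (fun t : ℝ => t) (gaussianReal 0 v) :=
    (memLp_id_gaussianReal (μ := 0) (v := v) 1).integrable (by simp)
  rw [gaussianReal_of_var_ne_zero _ hv, integrable_withDensity_iff_integrable_smul'
    (measurable_gaussianPDF _ _) (by simp [gaussianPDF])] at h1
  simp only [toReal_gaussianPDF, smul_eq_mul] at h1
  refine (h1.div_const (v : ℝ)).congr (ae_of_all _ fun t => ?_)
  ring

/-- The density times the logarithmic derivative of a function weighted by a Gaussian density is
integrable. -/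
theorem integrable_weighted_deriv {v : NNReal} (hv : v ≠ 0) {u u' : ℝ → ℝ} {C : ℝ}
    (hu : ∀ t, HasDerivAt u (u' t) t) (hC : ∀ t, |u t| ≤ C) (hC' : ∀ t, |u' t| ≤ C) :
    Integrable (fun t => gaussianPDFReal 0 v t * (t / v * u t - u' t)) := by
  have hum : AEStronglyMeasurable u volume :=
    (continuous_iff_continuousAt.2 fun t => (hu t).continuousAt).aestronglyMeasurable
  have hum' : AEStronglyMeasurable u' volume := by
    have : u' = deriv u := funext fun t => (hu t).deriv.symm
    rw [this]
    exact (measurable_deriv u).aestronglyMeasurable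
  have h1 := (integrable_div_mul_gaussianPDFReal hv).bdd_mul hum (ae_of_all _ hC)
  have h2 := (integrable_gaussianPDFReal 0 v).bdd_mul hum' (ae_of_all _ hC')
  refine (h1.sub h2).congr (ae_of_all _ fun t => ?_)
  simp only [Pi.sub_apply]
  ring

/-- The explicit primitive behind both the identification of $D^*$ and the boundary terms of
$\Gamma$. -/
theorem hasDerivAt_weighted (v : NNReal) {u u' : ℝ → ℝ} (hu : ∀ t, HasDerivAt u (u' t) t) (t : ℝ) :
    HasDerivAt (fun t => -(gaussianPDFReal 0 v t * u t))
      (gaussianPDFReal 0 v t * (t / v * u t - u' t)) t := by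
  exact ((hasDerivAt_gaussianPDFReal_zero v t).fun_mul (hu t)).fun_neg.congr_deriv (by ring)

theorem integral_weighted_deriv {v : NNReal} (hv : v ≠ 0) {u u' : ℝ → ℝ} {C : ℝ}
    (hu : ∀ t, HasDerivAt u (u' t) t) (hC : ∀ t, |u t| ≤ C) (hC' : ∀ t, |u' t| ≤ C) :
    ∫ t, gaussianPDFReal 0 v t * (t / v * u t - u' t) = 0 := by
  have hum : AEStronglyMeasurable u volume :=
    (continuous_iff_continuousAt.2 fun t => (hu t).continuousAt).aestronglyMeasurable
  refine integral_eq_zero_of_hasDerivAt_of_integrable (hasDerivAt_weighted v hu)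
    (integrable_weighted_deriv hv hu hC hC') ?_
  refine ((integrable_gaussianPDFReal 0 v).bdd_mul hum (ae_of_all _ hC)).neg.congr
    (ae_of_all _ fun t => ?_)
  simp [mul_comm]

theorem setIntegral_Icc_weighted_deriv {v : NNReal} (hv : v ≠ 0) {u u' : ℝ → ℝ} {C a b : ℝ}
    (hab : a ≤ b)
    (hu : ∀ t, HasDerivAt u (u' t) t) (hC : ∀ t, |u t| ≤ C) (hC' : ∀ t, |u' t| ≤ C) :
    ∫ t in Icc a b, gaussianPDFReal 0 v t * (t / v * u t - u' t)
      = gaussianPDFReal 0 v a * u a - gaussianPDFReal 0 v b * u b := by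
  rw [integral_Icc_eq_integral_Ioc, ← intervalIntegral.integral_of_le hab,
    intervalIntegral.integral_eq_sub_of_hasDerivAt (fun t _ => hasDerivAt_weighted v hu t)
      (integrable_weighted_deriv hv hu hC hC').intervalIntegrable]
  ring

end GaussianDensity

/-! ### Disintegration of the Gaussian measure along a direction. -/

section Slicing

variable {H : Type*} [NormedAddCommGroup H] [InnerProductSpace ℝ H] [CompleteSpace H]
  [SecondCountableTopology H] [MeasurableSpace H] [BorelSpace H]

/-- `κ` is the law of the component of `μ` transversal to `l`, where the coordinate along `l` is a
multiple of `⟨k, ·⟩`, is independent of that component and has variance `v`. -/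
structure IsSlicing (μ : Measure H) (k l : H) (v : NNReal) (κ : Measure H) : Prop where
  prob : IsProbabilityMeasure κ
  var_ne_zero : v ≠ 0
  map_eq : μ = ((gaussianReal 0 v).prod κ).map (fun p => p.1 • l + p.2)
  inner_eq_zero : ∀ᵐ y ∂κ, ⟪k, y⟫_ℝ = 0
  two_inner : 2 * ⟪k, l⟫_ℝ = 1 / v

/-- The covariance identity says that $\langle k,\cdot\rangle$ is dual to `l`: it is uncorrelated
with $\langle y,\cdot\rangle$ whenever $y\perp l$. Jointly Gaussian uncorrelated components are
independent, which splits $\mu$ into a product. -/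
theorem exists_isSlicing {μ : Measure H} [IsGaussian μ] (h0 : ∫ z, z ∂μ = 0) {k l : H}
    (hcov : ∀ y : H, ∫ z, ⟪k, z⟫_ℝ * ⟪y, z⟫_ℝ ∂μ = 1 / 2 * ⟪l, y⟫_ℝ) (hkl : 0 < ⟪k, l⟫_ℝ) :
    ∃ v κ, IsSlicing μ k l v κ := by
  set c := ⟪k, l⟫_ℝ with hc
  -- The normalization gives $T(l)=1$, so `Y` below is the projection along `l` onto the hyperplane
  -- $\langle k,\cdot\rangle=0$.
  set T : H →L[ℝ] ℝ := c⁻¹ • innerSL ℝ k with hT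
  have hTz : ∀ z, T z = c⁻¹ * ⟪k, z⟫_ℝ := fun z => by simp [hT]
  set Y : H →L[ℝ] H := ContinuousLinearMap.id ℝ H - T.smulRight l with hY
  have hYz : ∀ z, Y z = z - T z • l := fun z => by simp [hY]
  have hmean : ∀ L : StrongDual ℝ H, ∫ z, L z ∂μ = 0 := fun L => by
    rw [IsGaussian.integral_dual, h0, map_zero]
  have hint : ∀ x y : H, Integrable (fun z => ⟪x, z⟫_ℝ * ⟪y, z⟫_ℝ) μ := fun x y =>
    (IsGaussian.memLp_dual μ (innerSL ℝ x) 2 (by simp)).integrable_mul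
      (IsGaussian.memLp_dual μ (innerSL ℝ y) 2 (by simp))
  have hvar : ∫ z, ⟪k, z⟫_ℝ * ⟪k, z⟫_ℝ ∂μ = 1 / 2 * c := by
    rw [hcov k, real_inner_comm]
  have hgl : HasGaussianLaw (fun z => (T z, Y z)) μ := ⟨isGaussian_map (T.prod Y)⟩
  have hind : IndepFun T Y μ := by
    refine hgl.indepFun_of_covariance_inner fun x y => ?_
    have hm1 : ∫ z, ⟪x, T z⟫_ℝ ∂μ = 0 := by
      simpa using hmean ((innerSL ℝ x).comp T)
    have hm2 : ∫ z, ⟪y, Y z⟫_ℝ ∂μ = 0 := hmean ((innerSL ℝ y).comp Y)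
    rw [covariance, hm1, hm2]
    have he : ∀ z, (⟪x, T z⟫_ℝ - 0) * (⟪y, Y z⟫_ℝ - 0) = x * c⁻¹ * (⟪k, z⟫_ℝ * ⟪y, z⟫_ℝ)
        - x * c⁻¹ * c⁻¹ * ⟪y, l⟫_ℝ * (⟪k, z⟫_ℝ * ⟪k, z⟫_ℝ) := fun z => by
      rw [hYz, inner_sub_right, inner_smul_right, hTz]
      simp
      ring
    simp only [he]
    rw [integral_sub ((hint k y).const_mul _) ((hint k k).const_mul _), integral_const_mul,
      integral_const_mul, hvar, hcov y, real_inner_comm l y]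
    field_simp
    ring
  have hTlaw : μ.map T = gaussianReal 0 (Var[T; μ]).toNNReal := by
    rw [IsGaussian.map_eq_gaussianReal T, hmean]
  -- This is the value $v=1/(2\langle k,l\rangle)$ that turns $2\langle k,\cdot\rangle$ on a line
  -- into $t/v$, the logarithmic derivative of the Gaussian density up to sign.
  have hVar : Var[T; μ] = 1 / (2 * c) := by
    rw [variance_of_integral_eq_zero T.continuous.measurable.aemeasurable (hmean T)]
    have he : ∀ z, T z ^ 2 = c⁻¹ * c⁻¹ * (⟪k, z⟫_ℝ * ⟪k, z⟫_ℝ) := fun z => by rw [hTz]; ring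
    simp only [he]
    rw [integral_const_mul, hvar]
    field_simp
  have hpos : 0 < 1 / (2 * c) := by positivity
  refine ⟨(1 / (2 * c)).toNNReal, μ.map Y, ⟨?_, ?_, ?_, ?_, ?_⟩⟩
  · exact Measure.isProbabilityMeasure_map Y.continuous.measurable.aemeasurable
  · exact (Real.toNNReal_pos.2 hpos).ne'
  · have h1 := (indepFun_iff_map_prod_eq_prod_map_map T.continuous.measurable.aemeasurable
      Y.continuous.measurable.aemeasurable).1 hind
    rw [← hVar, ← hTlaw, ← h1, Measure.map_map (by fun_prop) (by fun_prop)]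
    have : ((fun p : ℝ × H => p.1 • l + p.2) ∘ fun ω => (T ω, Y ω)) = id := by
      funext z
      simp [hYz]
    rw [this, Measure.map_id]
  · rw [ae_map_iff Y.continuous.measurable.aemeasurable
      (measurableSet_eq_fun (by fun_prop) measurable_const)]
    refine ae_of_all _ fun z => ?_
    rw [hYz, inner_sub_right, inner_smul_right, hTz]
    field_simp
    rw [hc]; ring
  · rw [Real.coe_toNNReal _ hpos.le, ← hc]
    field_simp

variable {μ : Measure H} {k l : H} {v : NNReal} {κ : Measure H}

theorem IsSlicing.integrable_comp (hs : IsSlicing μ k l v κ) {f : H → ℝ} (hf : Integrable f μ) :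
    Integrable (fun p : ℝ × H => f (p.1 • l + p.2)) ((gaussianReal 0 v).prod κ) := by
  have := hf
  rw [hs.map_eq] at this
  exact this.comp_measurable (by fun_prop)

theorem IsSlicing.integral_eq (hs : IsSlicing μ k l v κ) {f : H → ℝ} (hf : Integrable f μ) :
    ∫ z, f z ∂μ = ∫ y, (∫ t, gaussianPDFReal 0 v t * f (t • l + y)) ∂κ := by
  have := hs.prob
  have h1 := hf
  rw [hs.map_eq] at h1
  conv_lhs => rw [hs.map_eq]
  rw [integral_map (by fun_prop) h1.1, integral_prod_symm _ (hs.integrable_comp hf)]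
  refine integral_congr_ae (ae_of_all _ fun y => ?_)
  simp only [integral_gaussianReal_eq_integral_smul hs.var_ne_zero, smul_eq_mul]

/-- Fubini: a set which is Lebesgue-null on every line parallel to `l` is $\mu$-null, the law along
`l` having a density. -/
theorem IsSlicing.ae_of (hs : IsSlicing μ k l v κ) {p : H → Prop} (hp : MeasurableSet {z | p z})
    (h : ∀ y, ∀ᵐ t : ℝ, p (t • l + y)) : ∀ᵐ z ∂μ, p z := by
  have := hs.prob
  rw [hs.map_eq, ae_map_iff (by fun_prop) hp]
  have hm : MeasurableSet {x : ℝ × H | p (x.1 • l + x.2)} :=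
    hp.preimage (f := fun x : ℝ × H => x.1 • l + x.2) (by fun_prop)
  rw [ae_iff, ← compl_ofPred, Measure.prod_apply_symm hm.compl, lintegral_eq_zero_iff
    (measurable_measure_prodMk_right hm.compl)]
  refine ae_of_all _ fun y => ?_
  exact ((gaussianReal_absolutelyContinuous 0 hs.var_ne_zero).ae_le (h y))

/-- The value of the adjoint of the gradient at the field `g • l`, where `k = A l`. -/
noncomputable def divStar (k l : H) (g : H → ℝ) (z : H) : ℝ := 2 * ⟪k, z⟫_ℝ * g z - ⟪gradient g z, l⟫_ℝ

theorem IsCb1.memLp_top (μ : Measure H) {g : H → ℝ} (hg : IsCb1 g) : MemLp g ∞ μ := by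
  obtain ⟨C, hC⟩ := hg.2.1
  exact memLp_top_of_bound hg.continuous.measurable.aestronglyMeasurable C (ae_of_all _ hC)

theorem IsCb1.memLp_top_gradient (μ : Measure H) {g : H → ℝ} (hg : IsCb1 g) (l : H) :
    MemLp (fun z => ⟪gradient g z, l⟫_ℝ) ∞ μ := by
  obtain ⟨C, hC⟩ := hg.exists_norm_gradient_le
  have h2 := measurable_gradient g
  refine memLp_top_of_bound (by fun_prop) (C * ‖l‖) (ae_of_all _ fun z => ?_)
  exact (norm_inner_le_norm _ _).trans (mul_le_mul_of_nonneg_right (hC z) (norm_nonneg _))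

theorem memLp_two_inner (μ : Measure H) [IsGaussian μ] (k : H) : MemLp (fun z => ⟪k, z⟫_ℝ) 2 μ :=
  IsGaussian.memLp_dual μ (innerSL ℝ k) 2 (by simp)

theorem memLp_two_divStar (μ : Measure H) [IsGaussian μ] (k l : H) {g : H → ℝ} (hg : IsCb1 g) :
    MemLp (divStar k l g) 2 μ := by
  have h1 : MemLp (fun z => ⟪k, z⟫_ℝ * g z) 2 μ := (hg.memLp_top μ).mul (memLp_two_inner μ k)
  have h2 := (hg.memLp_top_gradient μ l).mono_exponent (p := 2) le_top
  refine ((h1.const_mul 2).sub h2).ae_eq (ae_of_all _ fun z => ?_)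
  simp [divStar]; ring

theorem integrable_divStar (μ : Measure H) [IsGaussian μ] (k l : H) {g : H → ℝ} (hg : IsCb1 g) :
    Integrable (divStar k l g) μ := (memLp_two_divStar μ k l hg).integrable (by norm_num)

theorem IsSlicing.divStar_line (hs : IsSlicing μ k l v κ) (g : H → ℝ) {y : H}
    (hy : ⟪k, y⟫_ℝ = 0) (t : ℝ) : divStar k l g (t • l + y) =
      t / v * g (t • l + y) - ⟪gradient g (t • l + y), l⟫_ℝ := by
  have : 2 * ⟪k, t • l + y⟫_ℝ = t / v := by
    rw [inner_add_right, inner_smul_right, hy, add_zero]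
    calc 2 * (t * ⟪k, l⟫_ℝ) = t * (2 * ⟪k, l⟫_ℝ) := by ring
      _ = t / v := by rw [hs.two_inner]; ring
  rw [divStar, this]

theorem IsCb1.exists_line_bound {g : H → ℝ} (hg : IsCb1 g) (l : H) :
    ∃ C, ∀ z, |g z| ≤ C ∧ |⟪gradient g z, l⟫_ℝ| ≤ C := by
  obtain ⟨C, hC⟩ := hg.2.1
  obtain ⟨C', hC'⟩ := hg.exists_norm_gradient_le
  refine ⟨max C (C' * ‖l‖), fun z => ⟨(hC z).trans (le_max_left _ _), le_trans ?_ (le_max_right _ _)⟩⟩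
  exact (abs_real_inner_le_norm _ _).trans (mul_le_mul_of_nonneg_right (hC' z) (norm_nonneg _))

theorem IsSlicing.integral_divStar [IsGaussian μ] (hs : IsSlicing μ k l v κ) {g : H → ℝ}
    (hg : IsCb1 g) : ∫ z, divStar k l g z ∂μ = 0 := by
  rw [hs.integral_eq (integrable_divStar μ k l hg)]
  obtain ⟨C, hC⟩ := hg.exists_line_bound l
  rw [integral_eq_zero_of_ae]
  filter_upwards [hs.inner_eq_zero] with y hy
  simp only [hs.divStar_line g hy]
  exact integral_weighted_deriv hs.var_ne_zero (hg.hasDerivAt_line l y) (fun t => (hC _).1)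
    (fun t => (hC _).2)

/-- The product rule gives $D^*(gf\,l)=D^*(g\,l)f-\langle g\,l,Df\rangle$, and the left side has
mean zero. -/
theorem IsSlicing.isGradAdjoint [IsGaussian μ] (hs : IsSlicing μ k l v κ) {g : H → ℝ}
    (hg : IsCb1 g) : IsGradAdjoint μ (fun z => g z • l) (divStar k l g) := by
  refine ⟨memLp_two_divStar μ k l hg, fun f hf => ?_⟩
  have h0 := hs.integral_divStar (hg.mul hf)
  have he : ∀ z, divStar k l (fun z => g z * f z) z
      = divStar k l g z * f z - ⟪g z • l, gradient f z⟫_ℝ := fun z => by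
    rw [divStar, divStar, hg.gradient_mul hf, inner_add_left, inner_smul_left, inner_smul_left,
      inner_smul_left, real_inner_comm (gradient f z) l]
    simp
    ring
  have h1 : Integrable (fun z => divStar k l g z * f z) μ :=
    ((memLp_two_divStar μ k l hg).mul (hf.memLp_top μ)
      (r := 2)).integrable (by norm_num) |>.congr (ae_of_all _ fun z => mul_comm _ _)
  have h2 : Integrable (fun z => ⟪g z • l, gradient f z⟫_ℝ) μ := by
    have := ((hf.memLp_top_gradient μ l).mul (hg.memLp_top μ) (r := ∞)).integrable le_top
    refine this.congr (ae_of_all _ fun z => ?_)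
    simp
  simp only [he] at h0
  rw [integral_sub h1 h2, sub_eq_zero] at h0
  exact h0

end Slicing

/-! ### Uniqueness and additivity of $D^*$. -/

section GradAdjoint

variable {H : Type*} [NormedAddCommGroup H] [InnerProductSpace ℝ H] [CompleteSpace H]
  [MeasurableSpace H] [BorelSpace H]

/-- Two candidates for $D^*G$ have the same pairings with $C_b^1(H)$, which is enough to separate
integrable functions; so the chosen version may be replaced by any explicit one. -/
theorem gradAdjoint_ae_eq [SecondCountableTopology H] {μ : Measure H} [IsFiniteMeasure μ]
    {G : H → H} {w : H → ℝ} (hw : IsGradAdjoint μ G w) : gradAdjoint μ G =ᵐ[μ] w := by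
  have hex : ∃ w : H → ℝ, IsGradAdjoint μ G w := ⟨w, hw⟩
  have h1 : IsGradAdjoint μ G (gradAdjoint μ G) := by
    rw [gradAdjoint, dif_pos hex]; exact hex.choose_spec
  have hi1 := h1.1.integrable (by norm_num)
  have hi2 := hw.1.integrable (by norm_num)
  have h2 := ae_eq_zero_of_integral_mul_isCb1 μ (hi1.sub hi2) fun f hf => by
    obtain ⟨C, hC⟩ := hf.2.1
    have hm := hf.continuous.measurable.aestronglyMeasurable (μ := μ)
    have he : ∀ z, (gradAdjoint μ G - w) z * f z = gradAdjoint μ G z * f z - w z * f z := fun z => by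
      simp [sub_mul]
    simp only [he]
    rw [integral_sub (hi1.mul_bdd hm (ae_of_all _ hC)) (hi2.mul_bdd hm (ae_of_all _ hC)), h1.2 f hf, hw.2 f hf, sub_self]
  filter_upwards [h2] with z hz
  simpa [sub_eq_zero] using hz

theorem isGradAdjoint_sum {μ : Measure H} [IsFiniteMeasure μ] {ι : Type*} (s : Finset ι)
    {g : ι → H → ℝ} {l : ι → H} {w : ι → H → ℝ} (hg : ∀ j, IsCb1 (g j))
    (hw : ∀ j, IsGradAdjoint μ (fun z => g j z • l j) (w j)) :
    IsGradAdjoint μ (fun z => ∑ j ∈ s, g j z • l j) (fun z => ∑ j ∈ s, w j z) := by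
  refine ⟨memLp_finsetSum _ fun j _ => (hw j).1, fun f hf => ?_⟩
  obtain ⟨C, hC⟩ := hf.2.1
  obtain ⟨C', hC'⟩ := hf.exists_norm_gradient_le
  have hfm := hf.continuous.measurable.aestronglyMeasurable (μ := μ)
  have hD := measurable_gradient f
  simp only [Finset.sum_mul, sum_inner]
  rw [integral_finsetSum _ fun j _ => ((hw j).1.integrable (by norm_num)).mul_bdd hfm (ae_of_all _ hC),
    integral_finsetSum _ fun j _ => ?_]
  · exact Finset.sum_congr rfl fun j _ => (hw j).2 f hf
  · obtain ⟨C, hC⟩ := (hg j).2.1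
    have hgm := (hg j).continuous.measurable
    refine Integrable.of_bound (C := C * (‖l j‖ * C')) ?_ (ae_of_all _ fun z => ?_)
    · simp only [inner_smul_left]
      have : Measurable fun z => ⟪l j, gradient f z⟫_ℝ :=
        ((innerSL ℝ (l j)).continuous.measurable).comp hD
      exact (hgm.mul this).aestronglyMeasurable
    · rw [inner_smul_left, norm_mul]
      refine mul_le_mul (hC z) ?_ (norm_nonneg _) ((abs_nonneg _).trans (hC z))
      exact (norm_inner_le_norm _ _).trans (mul_le_mul_of_nonneg_left (hC' z) (norm_nonneg _))

end GradAdjoint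

/-! ### Sections of a convex set by parallel lines. -/

section LineSections

variable {H : Type*} [NormedAddCommGroup H] [InnerProductSpace ℝ H]

/-- The section of `Γ` by the line through `y` in the direction `l`. -/
def lineSection (Γ : Set H) (l y : H) : Set ℝ := {t | t • l + y ∈ Γ}

theorem isClosed_lineSection {Γ : Set H} (hΓ : IsClosed Γ) (l y : H) :
    IsClosed (lineSection Γ l y) :=
  hΓ.preimage (f := fun t : ℝ => t • l + y) (by fun_prop)

theorem convex_lineSection {Γ : Set H} (hΓ : Convex ℝ Γ) (l y : H) :
    Convex ℝ (lineSection Γ l y) := by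
  intro s hs t ht a b ha hb hab
  have := hΓ hs ht ha hb hab
  have he : a • (s • l + y) + b • (t • l + y) = (a • s + b • t) • l + y := by
    have : y = (a + b) • y := by rw [hab, one_smul]
    conv_rhs => rw [this]
    module
  rw [he] at this
  exact this

theorem isBounded_lineSection {Γ : Set H} (hΓ : Bornology.IsBounded Γ) {l : H} (hl : l ≠ 0) (y : H) :
    Bornology.IsBounded (lineSection Γ l y) := by
  obtain ⟨R, hR⟩ := hΓ.subset_closedBall 0
  have hl' : 0 < ‖l‖ := norm_pos_iff.2 hl
  refine (Metric.isBounded_closedBall (x := (0 : ℝ)) (r := (R + ‖y‖) / ‖l‖)).subset fun t ht => ?_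
  have h1 : ‖t • l + y‖ ≤ R := by simpa using hR ht
  have h2 : ‖t • l‖ ≤ R + ‖y‖ := by
    calc ‖t • l‖ = ‖(t • l + y) - y‖ := by simp
      _ ≤ ‖t • l + y‖ + ‖y‖ := norm_sub_le _ _
      _ ≤ R + ‖y‖ := by linarith
  rw [mem_closedBall_zero_iff, le_div_iff₀ hl', ← norm_smul]
  exact h2

theorem lineSection_eq_Icc {Γ : Set H} (hc : IsClosed Γ) (hconv : Convex ℝ Γ)
    (hb : Bornology.IsBounded Γ) {l : H} (hl : l ≠ 0) {y : H} (hy : (lineSection Γ l y).Nonempty) :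
    lineSection Γ l y = Icc (sInf (lineSection Γ l y)) (sSup (lineSection Γ l y)) :=
  eq_Icc_of_connected_compact ⟨hy, (convex_lineSection hconv l y).isPreconnected⟩
    (Metric.isCompact_of_isClosed_isBounded (isClosed_lineSection hc l y)
      (isBounded_lineSection hb hl y))

theorem sInf_mem_lineSection {Γ : Set H} (hc : IsClosed Γ)
    (hb : Bornology.IsBounded Γ) {l : H} (hl : l ≠ 0) {y : H} (hy : (lineSection Γ l y).Nonempty) :
    sInf (lineSection Γ l y) ∈ lineSection Γ l y :=
  (isClosed_lineSection hc l y).csInf_mem hy (isBounded_lineSection hb hl y).bddBelow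

theorem sSup_mem_lineSection {Γ : Set H} (hc : IsClosed Γ)
    (hb : Bornology.IsBounded Γ) {l : H} (hl : l ≠ 0) {y : H} (hy : (lineSection Γ l y).Nonempty) :
    sSup (lineSection Γ l y) ∈ lineSection Γ l y :=
  (isClosed_lineSection hc l y).csSup_mem hy (isBounded_lineSection hb hl y).bddAbove

/-- The set is the projection of a closed set along a compact factor, and such projections are
closed maps. This is the source of the measurability of the endpoints. -/
theorem isClosed_setOf_exists_lineSection {Γ : Set H} (hc : IsClosed Γ) (l : H) {K : Set ℝ}
    (hK : IsCompact K) : IsClosed {y | ∃ t ∈ K, t ∈ lineSection Γ l y} := by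
  have : CompactSpace K := isCompact_iff_compactSpace.1 hK
  have h1 : IsClosed {p : K × H | (p.1 : ℝ) • l + p.2 ∈ Γ} :=
    hc.preimage (f := fun p : K × H => (p.1 : ℝ) • l + p.2) (by fun_prop)
  convert isClosedMap_snd_of_compactSpace _ h1 using 1
  ext y
  constructor
  · rintro ⟨t, ht, hy⟩
    exact ⟨(⟨t, ht⟩, y), hy, rfl⟩
  · rintro ⟨⟨⟨t, ht⟩, y'⟩, hy, rfl⟩
    exact ⟨t, ht, hy⟩

variable [MeasurableSpace H] [BorelSpace H]

theorem measurableSet_exists_le_lineSection {Γ : Set H} (hc : IsClosed Γ) (l : H) (s : ℝ) :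
    MeasurableSet {y | ∃ t ≤ s, t ∈ lineSection Γ l y} := by
  have : {y | ∃ t ≤ s, t ∈ lineSection Γ l y}
      = ⋃ n : ℕ, {y | ∃ t ∈ Icc (-(n : ℝ)) s, t ∈ lineSection Γ l y} := by
    ext y
    simp only [mem_ofPred_eq, mem_iUnion]
    constructor
    · rintro ⟨t, hts, ht⟩
      obtain ⟨n, hn⟩ := exists_nat_ge (-t)
      exact ⟨n, t, ⟨by linarith, hts⟩, ht⟩
    · rintro ⟨n, t, h, ht⟩
      exact ⟨t, h.2, ht⟩
  rw [this]
  exact MeasurableSet.iUnion fun n =>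
    (isClosed_setOf_exists_lineSection hc l isCompact_Icc).measurableSet

theorem measurableSet_exists_ge_lineSection {Γ : Set H} (hc : IsClosed Γ) (l : H) (s : ℝ) :
    MeasurableSet {y | ∃ t ≥ s, t ∈ lineSection Γ l y} := by
  have : {y | ∃ t ≥ s, t ∈ lineSection Γ l y}
      = ⋃ n : ℕ, {y | ∃ t ∈ Icc s (n : ℝ), t ∈ lineSection Γ l y} := by
    ext y
    simp only [mem_ofPred_eq, mem_iUnion]
    constructor
    · rintro ⟨t, hts, ht⟩
      obtain ⟨n, hn⟩ := exists_nat_ge t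
      exact ⟨n, t, ⟨hts, hn⟩, ht⟩
    · rintro ⟨n, t, h, ht⟩
      exact ⟨t, h.1, ht⟩
  rw [this]
  exact MeasurableSet.iUnion fun n =>
    (isClosed_setOf_exists_lineSection hc l isCompact_Icc).measurableSet

theorem measurableSet_lineSection_nonempty {Γ : Set H} (hc : IsClosed Γ) (l : H) :
    MeasurableSet {y | (lineSection Γ l y).Nonempty} := by
  have : {y | (lineSection Γ l y).Nonempty} = ⋃ n : ℕ, {y | ∃ t ≤ (n : ℝ), t ∈ lineSection Γ l y} := by
    ext y
    simp only [mem_ofPred_eq, mem_iUnion]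
    constructor
    · rintro ⟨t, ht⟩
      obtain ⟨n, hn⟩ := exists_nat_ge t
      exact ⟨n, t, hn, ht⟩
    · rintro ⟨n, t, -, ht⟩
      exact ⟨t, ht⟩
  rw [this]
  exact MeasurableSet.iUnion fun n => measurableSet_exists_le_lineSection hc l n

theorem measurable_sInf_lineSection {Γ : Set H} (hc : IsClosed Γ) (hconv : Convex ℝ Γ)
    (hb : Bornology.IsBounded Γ) {l : H} (hl : l ≠ 0) :
    Measurable fun y => sInf (lineSection Γ l y) := by
  refine measurable_of_Iic fun s => ?_
  have hN := measurableSet_lineSection_nonempty hc l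
  -- An empty section has `sInf` equal to `0` by convention, which accounts for the second set of
  -- the union.
  have : (fun y => sInf (lineSection Γ l y)) ⁻¹' Iic s
      = {y | ∃ t ≤ s, t ∈ lineSection Γ l y} ∪
        ({y | (lineSection Γ l y).Nonempty}ᶜ ∩ {_y | (0 : ℝ) ≤ s}) := by
    ext y
    simp only [mem_preimage, mem_Iic, mem_union, mem_inter_iff, mem_compl_iff, mem_ofPred_eq]
    by_cases hy : (lineSection Γ l y).Nonempty
    · have h := lineSection_eq_Icc hc hconv hb hl hy
      have hle : sInf (lineSection Γ l y) ≤ sSup (lineSection Γ l y) := nonempty_Icc.1 (h ▸ hy)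
      simp only [hy, not_true, false_and, or_false]
      constructor
      · intro hs
        exact ⟨_, hs, sInf_mem_lineSection hc hb hl hy⟩
      · rintro ⟨t, hts, ht⟩
        rw [h] at ht
        exact ht.1.trans hts
    · have hy' := not_nonempty_iff_eq_empty.1 hy
      simp [hy']
  rw [this]
  exact (measurableSet_exists_le_lineSection hc l s).union (hN.compl.inter (MeasurableSet.const _))

theorem measurable_sSup_lineSection {Γ : Set H} (hc : IsClosed Γ) (hconv : Convex ℝ Γ)
    (hb : Bornology.IsBounded Γ) {l : H} (hl : l ≠ 0) :
    Measurable fun y => sSup (lineSection Γ l y) := by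
  refine measurable_of_Ici fun s => ?_
  have hN := measurableSet_lineSection_nonempty hc l
  have : (fun y => sSup (lineSection Γ l y)) ⁻¹' Ici s
      = {y | ∃ t ≥ s, t ∈ lineSection Γ l y} ∪
        ({y | (lineSection Γ l y).Nonempty}ᶜ ∩ {_y | s ≤ (0 : ℝ)}) := by
    ext y
    simp only [mem_preimage, mem_Ici, mem_union, mem_inter_iff, mem_compl_iff, mem_ofPred_eq]
    by_cases hy : (lineSection Γ l y).Nonempty
    · have h := lineSection_eq_Icc hc hconv hb hl hy
      have hle : sInf (lineSection Γ l y) ≤ sSup (lineSection Γ l y) := nonempty_Icc.1 (h ▸ hy)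
      simp only [hy, not_true, false_and, or_false]
      constructor
      · intro hs
        exact ⟨_, hs, sSup_mem_lineSection hc hb hl hy⟩
      · rintro ⟨t, hts, ht⟩
        rw [h] at ht
        exact le_trans hts ht.2
    · have hy' := not_nonempty_iff_eq_empty.1 hy
      simp [hy']
  rw [this]
  exact (measurableSet_exists_ge_lineSection hc l s).union (hN.compl.inter (MeasurableSet.const _))

/-- An interior point of `Γ` has a whole neighbourhood of parameters in the section. -/
theorem lineSection_mem_frontier {Γ : Set H} (hc : IsClosed Γ) {l y : H} {τ : ℝ}
    (hτ : τ ∈ lineSection Γ l y) (h : ∃ᶠ t in 𝓝 τ, t ∉ lineSection Γ l y) :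
    τ • l + y ∈ frontier Γ := by
  rw [hc.frontier_eq]
  refine ⟨hτ, fun hint => h ?_⟩
  have hcont : Tendsto (fun t : ℝ => t • l + y) (𝓝 τ) (𝓝 (τ • l + y)) :=
    Continuous.tendsto (by fun_prop) τ
  filter_upwards [hcont.eventually (isOpen_interior.mem_nhds hint)] with t ht
  exact not_not.2 (interior_subset (s := Γ) ht)

theorem sInf_lineSection_mem_frontier {Γ : Set H} (hc : IsClosed Γ)
    (hb : Bornology.IsBounded Γ) {l : H} (hl : l ≠ 0) {y : H} (hy : (lineSection Γ l y).Nonempty) :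
    sInf (lineSection Γ l y) • l + y ∈ frontier Γ :=
  lineSection_mem_frontier hc (sInf_mem_lineSection hc hb hl hy)
    ((frequently_lt_nhds _).mono fun _ ht ht' => absurd ht (not_lt.2
      (csInf_le (isBounded_lineSection hb hl y).bddBelow ht')))

theorem sSup_lineSection_mem_frontier {Γ : Set H} (hc : IsClosed Γ)
    (hb : Bornology.IsBounded Γ) {l : H} (hl : l ≠ 0) {y : H} (hy : (lineSection Γ l y).Nonempty) :
    sSup (lineSection Γ l y) • l + y ∈ frontier Γ :=
  lineSection_mem_frontier hc (sSup_mem_lineSection hc hb hl hy)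
    ((frequently_gt_nhds _).mono fun _ ht ht' => absurd ht (not_lt.2
      (le_csSup (isBounded_lineSection hb hl y).bddAbove ht')))

end LineSections

/-! ### Boundary measures and vanishing gradients by slicing. -/

section EndpointMeasures

variable {H : Type*} [NormedAddCommGroup H] [InnerProductSpace ℝ H] [CompleteSpace H]
  [SecondCountableTopology H] [MeasurableSpace H] [BorelSpace H]

theorem gaussianPDFReal_le (v : NNReal) (t : ℝ) :
    gaussianPDFReal 0 v t ≤ (√(2 * Real.pi * v))⁻¹ := by
  rw [gaussianPDFReal]
  refine mul_le_of_le_one_right (by positivity) (Real.exp_le_one_iff.2 ?_)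
  exact div_nonpos_of_nonpos_of_nonneg (neg_nonpos.2 (sq_nonneg _)) (by positivity)

/-- The image of `κ` (restricted to `N`) on the graph of `τ` over the hyperplane transversal to `l`,
weighted with the Gaussian density. -/
noncomputable def graphMeasure (κ : Measure H) (v : NNReal) (N : Set H) (τ : H → ℝ) (l : H) : Measure H :=
  ((κ.restrict N).withDensity fun y => gaussianPDF 0 v (τ y)).map fun y => τ y • l + y

variable {κ : Measure H} {v : NNReal} {N : Set H} {τ : H → ℝ} {l : H}

theorem isFiniteMeasure_graphMeasure [IsFiniteMeasure κ] :
    IsFiniteMeasure (graphMeasure κ v N τ l) := by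
  have : IsFiniteMeasure ((κ.restrict N).withDensity fun y => gaussianPDF 0 v (τ y)) := by
    refine isFiniteMeasure_withDensity (ne_of_lt ?_)
    calc ∫⁻ y in N, gaussianPDF 0 v (τ y) ∂κ ≤ ∫⁻ _ in N, ENNReal.ofReal (√(2 * Real.pi * v))⁻¹ ∂κ :=
          lintegral_mono fun y => ENNReal.ofReal_le_ofReal (gaussianPDFReal_le v _)
      _ < ∞ := by
          rw [lintegral_const]
          exact ENNReal.mul_lt_top ENNReal.ofReal_lt_top (measure_lt_top _ _)
  unfold graphMeasure
  infer_instance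

theorem graphMeasure_compl_eq_zero (hτ : Measurable τ) {F : Set H}
    (hF : MeasurableSet F) (h : ∀ y ∈ N, τ y • l + y ∈ F) : graphMeasure κ v N τ l Fᶜ = 0 := by
  rw [graphMeasure, Measure.map_apply (by fun_prop) hF.compl]
  refine withDensity_absolutelyContinuous _ _ ?_
  have hm : MeasurableSet ((fun y => τ y • l + y) ⁻¹' Fᶜ) := hF.compl.preimage (by fun_prop)
  rw [Measure.restrict_apply hm]
  convert measure_empty (μ := κ)
  ext y
  simp only [mem_inter_iff, mem_preimage, mem_compl_iff, mem_empty_iff_false, iff_false, not_and]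
  exact fun h1 h2 => h1 (h y h2)

theorem integral_graphMeasure (hτ : Measurable τ) {g : H → ℝ} (hg : Continuous g) :
    ∫ z, g z ∂(graphMeasure κ v N τ l)
      = ∫ y in N, gaussianPDFReal 0 v (τ y) * g (τ y • l + y) ∂κ := by
  rw [graphMeasure, integral_map (by fun_prop) hg.measurable.aestronglyMeasurable,
    integral_withDensity_eq_integral_toReal_smul (f := fun y => gaussianPDF 0 v (τ y))
      ((measurable_gaussianPDF _ _).comp hτ) (ae_of_all _ fun y => by simp [gaussianPDF])]
  simp only [toReal_gaussianPDF, smul_eq_mul]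

theorem integrable_graphMeasure_aux [IsFiniteMeasure κ] (hτ : Measurable τ) {g : H → ℝ}
    (hg : IsCb1 g) : IntegrableOn (fun y => gaussianPDFReal 0 v (τ y) * g (τ y • l + y)) N κ := by
  obtain ⟨C, hC⟩ := hg.2.1
  have hgm := hg.continuous.measurable
  have hφ := measurable_gaussianPDFReal 0 v
  refine Integrable.of_bound (C := (√(2 * Real.pi * v))⁻¹ * C)
    (by fun_prop) (ae_of_all _ fun y => ?_)
  rw [norm_mul, Real.norm_of_nonneg (gaussianPDFReal_nonneg _ _ _)]
  exact mul_le_mul (gaussianPDFReal_le v _) (hC _) (norm_nonneg _) (by positivity)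

/-- The distributional derivative of the indicator function of a convex set in a direction of
slicing is the difference of two finite measures carried by the boundary. -/
theorem IsSlicing.exists_boundary_measures {μ : Measure H} [IsGaussian μ] {k : H}
    (hs : IsSlicing μ k l v κ) {Γ : Set H} (hc : IsClosed Γ) (hconv : Convex ℝ Γ)
    (hb : Bornology.IsBounded Γ) :
    ∃ ν₁ ν₂ : Measure H, IsFiniteMeasure ν₁ ∧ IsFiniteMeasure ν₂ ∧ ν₁ (frontier Γ)ᶜ = 0 ∧
      ν₂ (frontier Γ)ᶜ = 0 ∧ ∀ g : H → ℝ, IsCb1 g →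
        ∫ z in Γ, divStar k l g z ∂μ = ∫ z, g z ∂ν₁ - ∫ z, g z ∂ν₂ := by
  have := hs.prob
  have hl : l ≠ 0 := by
    rintro rfl
    have := hs.two_inner
    rw [inner_zero_right, mul_zero, eq_comm, one_div, inv_eq_zero] at this
    exact hs.var_ne_zero (by exact_mod_cast this)
  have hN := measurableSet_lineSection_nonempty hc l
  have ha := measurable_sInf_lineSection hc hconv hb hl
  have hb' := measurable_sSup_lineSection hc hconv hb hl
  have hF : MeasurableSet (frontier Γ) := isClosed_frontier.measurableSet
  -- The lower endpoint enters with a plus sign and the upper one with a minus sign, since the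
  -- primitive on the line is $-\varphi g$, where $\varphi$ is the Gaussian density.
  refine ⟨graphMeasure κ v {y | (lineSection Γ l y).Nonempty} (fun y => sInf (lineSection Γ l y)) l,
    graphMeasure κ v {y | (lineSection Γ l y).Nonempty} (fun y => sSup (lineSection Γ l y)) l,
    isFiniteMeasure_graphMeasure, isFiniteMeasure_graphMeasure,
    graphMeasure_compl_eq_zero ha hF fun y hy => sInf_lineSection_mem_frontier hc hb hl hy,
    graphMeasure_compl_eq_zero hb' hF fun y hy => sSup_lineSection_mem_frontier hc hb hl hy,
    fun g hg => ?_⟩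
  obtain ⟨C, hC⟩ := hg.exists_line_bound l
  rw [integral_graphMeasure ha hg.continuous, integral_graphMeasure hb' hg.continuous,
    ← integral_sub (integrable_graphMeasure_aux ha hg) (integrable_graphMeasure_aux hb' hg),
    ← integral_indicator hc.measurableSet,
    hs.integral_eq ((integrable_divStar μ k l hg).indicator hc.measurableSet),
    ← integral_indicator hN]
  refine integral_congr_ae ?_
  filter_upwards [hs.inner_eq_zero] with y hy
  have h1 : ∀ t : ℝ, gaussianPDFReal 0 v t * Γ.indicator (divStar k l g) (t • l + y)
      = (lineSection Γ l y).indicator (fun t => gaussianPDFReal 0 v t *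
        (t / v * g (t • l + y) - ⟪gradient g (t • l + y), l⟫_ℝ)) t := by
    intro t
    by_cases ht : t ∈ lineSection Γ l y
    · rw [indicator_of_mem ht, indicator_of_mem (show t • l + y ∈ Γ from ht), hs.divStar_line g hy]
    · rw [indicator_of_notMem ht, indicator_of_notMem (show t • l + y ∉ Γ from ht), mul_zero]
  simp only [h1]
  rw [integral_indicator (isClosed_lineSection hc l y).measurableSet]
  by_cases hy' : (lineSection Γ l y).Nonempty
  · have h := lineSection_eq_Icc hc hconv hb hl hy'
    have hle : sInf (lineSection Γ l y) ≤ sSup (lineSection Γ l y) := nonempty_Icc.1 (h ▸ hy')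
    rw [indicator_of_mem (show y ∈ {y | (lineSection Γ l y).Nonempty} from hy')]
    conv_lhs => rw [h]
    exact setIntegral_Icc_weighted_deriv hs.var_ne_zero hle (hg.hasDerivAt_line l y)
      (fun t => (hC _).1) (fun t => (hC _).2)
  · rw [indicator_of_notMem (show y ∉ {y | (lineSection Γ l y).Nonempty} from hy'),
      not_nonempty_iff_eq_empty.1 hy']
    simp

/-- A function of class `C_b^1` which vanishes on a closed convex set has, at almost every point of
this set, vanishing derivative in any direction of slicing. -/
theorem IsSlicing.inner_gradient_eq_zero {μ : Measure H} {k : H} (hs : IsSlicing μ k l v κ)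
    {Γ : Set H} (hc : IsClosed Γ) (hconv : Convex ℝ Γ) {f : H → ℝ} (hf : IsCb1 f)
    (h0 : ∀ z ∈ Γ, f z = 0) : ∀ᵐ z ∂μ, z ∈ Γ → ⟪gradient f z, l⟫_ℝ = 0 := by
  have hD := measurable_gradient f
  refine hs.ae_of ?_ fun y => ?_
  · have h1 : MeasurableSet {z | ⟪gradient f z, l⟫_ℝ = 0} :=
      measurableSet_eq_fun (by fun_prop) measurable_const
    have : {z | z ∈ Γ → ⟪gradient f z, l⟫_ℝ = 0} = Γᶜ ∪ {z | ⟪gradient f z, l⟫_ℝ = 0} := by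
      ext z; simp [imp_iff_not_or]
    rw [this]
    exact hc.measurableSet.compl.union h1
  -- A section with at most one point is null. Any other contains an interval, and a convex set with
  -- interior determines derivatives at all of its points, endpoints included.
  · by_cases hsub : (lineSection Γ l y).Subsingleton
    · have : volume (lineSection Γ l y) = 0 := hsub.measure_zero _
      have h2 : ∀ᵐ t : ℝ, t ∉ lineSection Γ l y := measure_eq_zero_iff_ae_notMem.1 this
      filter_upwards [h2] with t ht ht' using absurd ht' ht
    · have hint : (interior (lineSection Γ l y)).Nonempty := by
        obtain ⟨a, ha, b, hb, hab⟩ := not_subsingleton_iff.1 hsub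
        wlog hlt : a < b generalizing a b
        · exact this b hb a ha hab.symm (lt_of_le_of_ne (not_lt.1 hlt) hab.symm)
        refine ⟨(a + b) / 2, interior_mono
          ((convex_lineSection hconv l y).ordConnected.out ha hb) ?_⟩
        rw [interior_Icc]
        constructor <;> linarith
      have hu := uniqueDiffOn_convex (convex_lineSection hconv l y) hint
      refine ae_of_all _ fun t ht => ?_
      have hd := (hf.hasDerivAt_line l y t).hasDerivWithinAt (s := lineSection Γ l y)
      have hd0 : HasDerivWithinAt (fun t : ℝ => f (t • l + y)) 0 (lineSection Γ l y) t :=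
        (hasDerivWithinAt_const t (lineSection Γ l y) (0 : ℝ)).congr (fun s hs => h0 _ hs) (h0 _ ht)
      exact (hu t ht).eq_deriv _ hd hd0

end EndpointMeasures

/-! ### Symmetry of $A$ against eigenvectors. -/

section SelfAdjoint

variable {H : Type*} [NormedAddCommGroup H] [InnerProductSpace ℝ H] [CompleteSpace H]

theorem IsSelfAdjoint.inner_apply_left {A : H →ₗ.[ℝ] H} (hA : IsSelfAdjoint A) (x y : A.domain) :
    ⟪A x, (y : H)⟫_ℝ = ⟪(x : H), A y⟫_ℝ := by
  have h := LinearPMap.adjoint_isFormalAdjoint hA.dense_domain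
  rw [LinearPMap.isSelfAdjoint_def.1 hA] at h
  exact h x y

theorem inner_apply_eigenvector {A : H →ₗ.[ℝ] H} (hA : IsSelfAdjoint A) {ι : Type*} {e : ι → H}
    (he : ∀ i, e i ∈ A.domain) {α : ι → ℝ} (hα : ∀ i, A ⟨e i, he i⟩ = α i • e i) (l : A.domain)
    (i : ι) : ⟪A l, e i⟫_ℝ = α i * ⟪(l : H), e i⟫_ℝ := by
  rw [hA.inner_apply_left l ⟨e i, he i⟩, hα, inner_smul_right]

end SelfAdjoint

/-! ### $D^*$ on test fields, and passage from the eigenbasis to $D(A)$. -/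

section TestFields

variable {H : Type*} [NormedAddCommGroup H] [InnerProductSpace ℝ H] [CompleteSpace H]
  [SecondCountableTopology H] [MeasurableSpace H] [BorelSpace H]
  {A : H →ₗ.[ℝ] H} {δ : ℝ} {Ainv : H →L[ℝ] H} {μ : Measure H}

theorem exists_isSlicing_of_mem_domain (hδ : 0 < δ)
    (hAδ : ∀ x : A.domain, δ * ‖(x : H)‖ ^ 2 ≤ ⟪A x, (x : H)⟫_ℝ) (hAinv : IsBoundedInverse A Ainv)
    (hμ : IsCenteredGaussian μ ((1 / 2 : ℝ) • Ainv)) (l : A.domain) (hl : (l : H) ≠ 0) :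
    ∃ v κ, IsSlicing μ (A l) l v κ := by
  have := hμ.isGaussian
  refine exists_isSlicing hμ.mean_zero (fun y => ?_) ?_
  · rw [hμ.covariance, smul_apply, hAinv.2, inner_smul_left]
    simp
  · have h1 : 0 < ‖(l : H)‖ := norm_pos_iff.2 hl
    exact lt_of_lt_of_le (by positivity) (hAδ l)

theorem isGradAdjoint_smul (hδ : 0 < δ)
    (hAδ : ∀ x : A.domain, δ * ‖(x : H)‖ ^ 2 ≤ ⟪A x, (x : H)⟫_ℝ) (hAinv : IsBoundedInverse A Ainv)
    (hμ : IsCenteredGaussian μ ((1 / 2 : ℝ) • Ainv)) (l : A.domain) {g : H → ℝ} (hg : IsCb1 g) :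
    IsGradAdjoint μ (fun z => g z • (l : H)) (divStar (A l) l g) := by
  have := hμ.isGaussian
  -- Slicing needs a nonzero direction; for `l = 0` both sides vanish.
  by_cases hl : (l : H) = 0
  · have hl' : l = 0 := Subtype.ext hl
    refine ⟨memLp_two_divStar μ _ _ hg, fun f _ => ?_⟩
    simp [divStar, hl', map_zero]
  · obtain ⟨v, κ, hs⟩ := exists_isSlicing_of_mem_domain hδ hAδ hAinv hμ l hl
    exact hs.isGradAdjoint hg

theorem setIntegral_gradAdjoint_sum (hδ : 0 < δ)
    (hAδ : ∀ x : A.domain, δ * ‖(x : H)‖ ^ 2 ≤ ⟪A x, (x : H)⟫_ℝ) (hAinv : IsBoundedInverse A Ainv)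
    (hμ : IsCenteredGaussian μ ((1 / 2 : ℝ) • Ainv)) {ι : Type*} (s : Finset ι) (l : ι → A.domain)
    {g : ι → H → ℝ} (hg : ∀ i, IsCb1 (g i)) (Γ : Set H) :
    ∫ z in Γ, gradAdjoint μ (fun z => ∑ i ∈ s, g i z • (l i : H)) z ∂μ
      = ∑ i ∈ s, ∫ z in Γ, divStar (A (l i)) (l i) (g i) z ∂μ := by
  have := hμ.isGaussian
  rw [← integral_finsetSum _ fun i _ => (integrable_divStar μ _ _ (hg i)).integrableOn]
  exact integral_congr_ae (ae_restrict_of_ae (gradAdjoint_ae_eq (isGradAdjoint_sum s hg fun i =>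
    isGradAdjoint_smul hδ hAδ hAinv hμ (l i) (hg i))))

theorem isTestField_sum {ι : Type*} (s : Finset ι) (l : ι → A.domain) {g : ι → H → ℝ}
    (hg : ∀ i, IsCb1 (g i)) : IsTestField A (fun z => ∑ i ∈ s, g i z • (l i : H)) := by
  refine ⟨s.card, fun j => g (s.equivFin.symm j), fun j => l (s.equivFin.symm j),
    fun j => hg _, fun z => ?_⟩
  rw [Equiv.sum_comp s.equivFin.symm (fun i : s => g i z • (l i : H)),
    Finset.sum_coe_sort s (fun i => g i z • (l i : H))]

theorem isTestField_smul (l : A.domain) {g : H → ℝ} (hg : IsCb1 g) :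
    IsTestField A (fun z => g z • (l : H)) :=
  ⟨1, fun _ => g, fun _ => l, fun _ => hg, fun z => by simp⟩

theorem setIntegral_gradAdjoint_smul (hδ : 0 < δ)
    (hAδ : ∀ x : A.domain, δ * ‖(x : H)‖ ^ 2 ≤ ⟪A x, (x : H)⟫_ℝ) (hAinv : IsBoundedInverse A Ainv)
    (hμ : IsCenteredGaussian μ ((1 / 2 : ℝ) • Ainv)) (l : A.domain) {g : H → ℝ} (hg : IsCb1 g)
    (Γ : Set H) :
    ∫ z in Γ, gradAdjoint μ (fun z => g z • (l : H)) z ∂μ = ∫ z in Γ, divStar (A l) l g z ∂μ := by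
  have := hμ.isGaussian
  exact integral_congr_ae (ae_restrict_of_ae (gradAdjoint_ae_eq
    (isGradAdjoint_smul hδ hAδ hAinv hμ l hg)))

theorem integral_mul_ind {Γ : Set H} (hΓ : MeasurableSet Γ) (f : H → ℝ) :
    ∫ z, f z * ind Γ z ∂μ = ∫ z in Γ, f z ∂μ := by
  rw [← integral_indicator hΓ]
  refine integral_congr_ae (ae_of_all _ fun z => ?_)
  by_cases hz : z ∈ Γ <;> simp [ind, hz]

/-- An identity for the directional derivatives along a basis of eigenvectors extends to all
directions in the domain of `A`. -/
theorem setIntegral_divStar_of_eigenbasis (hA : IsSelfAdjoint A) [IsGaussian μ]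
    {ι : Type*} {e : HilbertBasis ι ℝ H} (he : ∀ i, e i ∈ A.domain)
    {α : ι → ℝ} (hα : ∀ i, A ⟨e i, he i⟩ = α i • e i) {Γ : Set H} {m : Measure H} {X : H → H}
    (hX : Integrable X m) {g : H → ℝ} (hg : IsCb1 g)
    (h : ∀ i, ∫ z in Γ, divStar (A ⟨e i, he i⟩) (e i) g z ∂μ = ∫ z, g z * ⟪e i, X z⟫_ℝ ∂m)
    (l : A.domain) :
    ∫ z in Γ, divStar (A l) l g z ∂μ = ∫ z, g z * ⟪(l : H), X z⟫_ℝ ∂m := by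
  obtain ⟨C, hC⟩ := hg.2.1
  obtain ⟨C', hC'⟩ := hg.exists_norm_gradient_le
  have hgm := hg.continuous.measurable
  have hgX : Integrable (fun z => g z • X z) m :=
    hX.bdd_smul C hgm.aestronglyMeasurable (ae_of_all _ hC)
  have hgz : IntegrableOn (fun z => g z • z) Γ μ :=
    ((IsGaussian.integrable_id (μ := μ)).bdd_smul C
      hgm.aestronglyMeasurable (ae_of_all _ hC)).integrableOn
  have hDg : IntegrableOn (gradient g) Γ μ :=
    (Integrable.of_bound (measurable_gradient g).aestronglyMeasurable C' (ae_of_all _ hC')).integrableOn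
  -- Both sides of the identity become scalar products of `l` and `A l` with fixed vectors of `H`,
  -- so Parseval's identity reduces the claim to the coordinates.
  have h1 : ∀ x : H, ∫ z, g z * ⟪x, X z⟫_ℝ ∂m = ⟪x, ∫ z, g z • X z ∂m⟫_ℝ := fun x => by
    rw [← integral_inner hgX]
    simp only [inner_smul_right]
  have h2 : ∀ k x : H, ∫ z in Γ, divStar k x g z ∂μ
      = 2 * ⟪k, ∫ z in Γ, g z • z ∂μ⟫_ℝ - ⟪x, ∫ z in Γ, gradient g z ∂μ⟫_ℝ := fun k x => by
    rw [← integral_inner hgz, ← integral_inner hDg, ← integral_const_mul,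
      ← integral_sub ((hgz.const_inner k).const_mul 2) (hDg.const_inner x)]
    refine integral_congr_ae (ae_of_all _ fun z => ?_)
    simp only [divStar, inner_smul_right]
    rw [real_inner_comm (gradient g z) x]
    ring
  simp only [h1, h2] at h ⊢
  set w := ∫ z, g z • X z ∂m
  set p := ∫ z in Γ, g z • z ∂μ
  set q := ∫ z in Γ, gradient g z ∂μ
  have e1 := e.hasSum_inner_mul_inner (l : H) w
  have e2 := (((e.hasSum_inner_mul_inner (A l) p).mul_left 2).sub (e.hasSum_inner_mul_inner (l : H) q))
  have h3 : ∀ i, ⟪(l : H), e i⟫_ℝ * ⟪e i, w⟫_ℝ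
      = 2 * (⟪A l, e i⟫_ℝ * ⟪e i, p⟫_ℝ) - ⟪(l : H), e i⟫_ℝ * ⟪e i, q⟫_ℝ := fun i => by
    rw [← h i, hα, inner_apply_eigenvector hA he hα, inner_smul_left]
    simp
    ring
  simp only [h3] at e1
  exact e2.unique e1

end TestFields

/-! ### Fields reconstructed from their coordinates. -/

section VectorDensity

variable {H : Type*} [NormedAddCommGroup H] [InnerProductSpace ℝ H] [CompleteSpace H]
  [SecondCountableTopology H] [MeasurableSpace H] [BorelSpace H] {ι : Type*} [Countable ι]

theorem memℓp_two_of_tsum_enorm_sq {ι : Type*} {c : ι → ℝ} (hc : ∑' i, ‖c i‖ₑ ^ 2 < ∞) :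
    Memℓp c 2 := by
  refine memℓp_gen ?_
  have h1 : ∑' i, ENNReal.ofReal (c i ^ 2) ≠ ∞ := by
    refine ne_of_lt (lt_of_eq_of_lt (tsum_congr fun i => ?_) hc)
    rw [← sq_abs, ENNReal.ofReal_pow (abs_nonneg _), ← Real.enorm_eq_ofReal_abs]
  refine (ENNReal.summable_toReal h1).congr fun i => ?_
  rw [ENNReal.toReal_ofReal (sq_nonneg _)]
  simp

/-- Measurable coordinates which are almost everywhere square summable are the coordinates of a
measurable field. -/
theorem exists_measurable_field (e : HilbertBasis ι ℝ H) {m : Measure H} {h : ι → H → ℝ}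
    (hm : ∀ i, Measurable (h i)) (hfin : ∀ᵐ z ∂m, ∑' i, ‖h i z‖ₑ ^ 2 < ∞) :
    ∃ X : H → H, Measurable X ∧ ∀ᵐ z ∂m, ∀ i, ⟪e i, X z⟫_ℝ = h i z := by
  -- The coordinates are set to zero off the set of square summability, so that the field is defined
  -- everywhere and is a pointwise limit of measurable partial sums.
  set Z : Set H := {z | ∑' i, ‖h i z‖ₑ ^ 2 < ∞} with hZ
  have hZm : MeasurableSet Z :=
    measurableSet_lt (Measurable.tsum fun i => (hm i).enorm.pow_const 2) measurable_const
  have hmem : ∀ z, Memℓp (fun i => Z.indicator (h i) z) 2 := by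
    intro z
    refine memℓp_two_of_tsum_enorm_sq ?_
    by_cases hz : z ∈ Z
    · have hz' : ∑' i, ‖h i z‖ₑ ^ 2 < ∞ := hz
      simpa only [indicator_of_mem hz] using hz'
    · simp [indicator_of_notMem hz]
  set X : H → H := fun z => e.repr.symm ⟨fun i => Z.indicator (h i) z, hmem z⟩ with hX
  refine ⟨X, ?_, ?_⟩
  · refine measurable_of_tendsto_metrizable' (atTop : Filter (Finset ι))
      (f := fun s z => ∑ i ∈ s, Z.indicator (h i) z • e i) (fun s => ?_) ?_
    · exact Finset.measurable_fun_sum s fun i _ => ((hm i).indicator hZm).smul_const (e i)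
    · rw [tendsto_pi_nhds]
      intro z
      exact e.hasSum_repr_symm ⟨fun i => Z.indicator (h i) z, hmem z⟩
  · filter_upwards [hfin] with z hz i
    rw [← e.repr_apply_apply, hX]
    simp only [LinearIsometryEquiv.apply_symm_apply]
    exact indicator_of_mem (show z ∈ Z from hz) _

theorem HilbertBasis.tsum_enorm_inner_sq (e : HilbertBasis ι ℝ H) (x : H) :
    ∑' i, ‖⟪e i, x⟫_ℝ‖ₑ ^ 2 = ‖x‖ₑ ^ 2 := by
  have h1 := e.hasSum_inner_mul_inner x x
  rw [real_inner_self_eq_norm_sq] at h1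
  have h2 : ∀ i, ‖⟪e i, x⟫_ℝ‖ₑ ^ 2 = ENNReal.ofReal (⟪x, e i⟫_ℝ * ⟪e i, x⟫_ℝ) := fun i => by
    rw [real_inner_comm x (e i), ← sq, ← sq_abs ⟪x, e i⟫_ℝ, ENNReal.ofReal_pow (abs_nonneg _),
      ← Real.enorm_eq_ofReal_abs]
  simp only [h2]
  rw [← ENNReal.ofReal_tsum_of_nonneg (fun i => ?_) h1.summable, h1.tsum_eq,
    ENNReal.ofReal_pow (norm_nonneg _), ofReal_norm]
  rw [real_inner_comm x (e i)]
  exact mul_self_nonneg _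

end VectorDensity

/-! ### Existence of the surface measure and normal. -/

section Existence

variable {H : Type*} [NormedAddCommGroup H] [InnerProductSpace ℝ H] [CompleteSpace H]
  [SecondCountableTopology H] [MeasurableSpace H] [BorelSpace H]
  {A : H →ₗ.[ℝ] H} {δ : ℝ} {Ainv : H →L[ℝ] H} {μ : Measure H} {ι : Type*} [Countable ι]

/-- The directional derivatives of the indicator function of a convex set have densities with
respect to a common finite measure carried by the boundary. -/
theorem exists_boundary_densities (hδ : 0 < δ)
    (hAδ : ∀ x : A.domain, δ * ‖(x : H)‖ ^ 2 ≤ ⟪A x, (x : H)⟫_ℝ) (hAinv : IsBoundedInverse A Ainv)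
    (hμ : IsCenteredGaussian μ ((1 / 2 : ℝ) • Ainv)) (l : ι → A.domain) (hl : ∀ i, (l i : H) ≠ 0)
    {Γ : Set H} (hc : IsClosed Γ) (hconv : Convex ℝ Γ) (hb : Bornology.IsBounded Γ) :
    ∃ (m : Measure H) (h : ι → H → ℝ), IsFiniteMeasure m ∧ m (frontier Γ)ᶜ = 0 ∧
      (∀ i, Measurable (h i)) ∧ (∀ i, Integrable (h i) m) ∧ ∀ i (g : H → ℝ), IsCb1 g →
        ∫ z in Γ, divStar (A (l i)) (l i) g z ∂μ = ∫ z, g z * h i z ∂m := by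
  have := hμ.isGaussian
  have key : ∀ i, ∃ ν₁ ν₂ : Measure H, IsFiniteMeasure ν₁ ∧ IsFiniteMeasure ν₂ ∧
      ν₁ (frontier Γ)ᶜ = 0 ∧ ν₂ (frontier Γ)ᶜ = 0 ∧ ∀ g : H → ℝ, IsCb1 g →
        ∫ z in Γ, divStar (A (l i)) (l i) g z ∂μ = ∫ z, g z ∂ν₁ - ∫ z, g z ∂ν₂ := fun i => by
    obtain ⟨v, κ, hs⟩ := exists_isSlicing_of_mem_domain hδ hAδ hAinv hμ (l i) (hl i)
    exact hs.exists_boundary_measures hc hconv hb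
  choose ν₁ ν₂ hf₁ hf₂ h0₁ h0₂ hν using key
  -- The countable sum need not be finite; `toFinite` replaces it by an equivalent finite measure,
  -- to which Radon–Nikodym applies.
  set m₀ : Measure H := Measure.sum fun i => ν₁ i + ν₂ i with hm₀
  have hac₁ : ∀ i, ν₁ i ≪ m₀.toFinite := fun i =>
    ((Measure.AbsolutelyContinuous.rfl.add_right (ν₂ i)).trans
      (Measure.absolutelyContinuous_sum_right i Measure.AbsolutelyContinuous.rfl)).trans
        (absolutelyContinuous_toFinite m₀)
  have hac₂ : ∀ i, ν₂ i ≪ m₀.toFinite := fun i =>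
    ((show ν₂ i ≪ ν₁ i + ν₂ i from by
      rw [add_comm]; exact Measure.AbsolutelyContinuous.rfl.add_right (ν₁ i)).trans
      (Measure.absolutelyContinuous_sum_right i Measure.AbsolutelyContinuous.rfl)).trans
        (absolutelyContinuous_toFinite m₀)
  have hr : ∀ ν : Measure H, IsFiniteMeasure ν → ν ≪ m₀.toFinite → ∀ g : H → ℝ, IsCb1 g →
      Integrable (fun z => g z * (ν.rnDeriv m₀.toFinite z).toReal) m₀.toFinite ∧
      ∫ z, g z ∂ν = ∫ z, g z * (ν.rnDeriv m₀.toFinite z).toReal ∂m₀.toFinite := by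
    intro ν _ hac g hg
    obtain ⟨C, hC⟩ := hg.2.1
    refine ⟨Measure.integrable_toReal_rnDeriv.bdd_mul hg.continuous.measurable.aestronglyMeasurable
      (ae_of_all _ hC), ?_⟩
    rw [← integral_rnDeriv_smul hac]
    simp only [smul_eq_mul, mul_comm]
  refine ⟨m₀.toFinite, fun i z => ((ν₁ i).rnDeriv m₀.toFinite z).toReal
    - ((ν₂ i).rnDeriv m₀.toFinite z).toReal, inferInstance, ?_, fun i => ?_, fun i => ?_,
    fun i g hg => ?_⟩
  · refine toFinite_absolutelyContinuous m₀ ?_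
    rw [Measure.sum_apply _ isClosed_frontier.measurableSet.compl]
    simp [h0₁, h0₂]
  · exact (Measure.measurable_rnDeriv _ _).ennreal_toReal.sub
      (Measure.measurable_rnDeriv _ _).ennreal_toReal
  · exact Measure.integrable_toReal_rnDeriv.sub Measure.integrable_toReal_rnDeriv
  · obtain ⟨i1, e1⟩ := hr (ν₁ i) (hf₁ i) (hac₁ i) g hg
    obtain ⟨i2, e2⟩ := hr (ν₂ i) (hf₂ i) (hac₂ i) g hg
    rw [hν i g hg, e1, e2, ← integral_sub i1 i2]
    simp only [mul_sub]

theorem norm_sum_smul_sq {e : ι → H} (he : Orthonormal ℝ e) (s : Finset ι) (c : ι → ℝ) :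
    ‖∑ i ∈ s, c i • e i‖ ^ 2 = ∑ i ∈ s, c i ^ 2 := by
  rw [← real_inner_self_eq_norm_sq, he.inner_sum]
  exact Finset.sum_congr rfl fun i _ => by simp [sq]

/-- The total mass of the density of the distributional derivative of an indicator function is at
most the total variation. -/
theorem lintegral_tsum_le_totalVar (hδ : 0 < δ)
    (hAδ : ∀ x : A.domain, δ * ‖(x : H)‖ ^ 2 ≤ ⟪A x, (x : H)⟫_ℝ) (hAinv : IsBoundedInverse A Ainv)
    (hμ : IsCenteredGaussian μ ((1 / 2 : ℝ) • Ainv))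
    {e : ι → H} (hon : Orthonormal ℝ e) (he : ∀ i, e i ∈ A.domain)
    {Γ : Set H} (hc : IsClosed Γ) (hV : totalVar A μ (ind Γ) < ∞) {m : Measure H}
    [IsFiniteMeasure m] {h : ι → H → ℝ} (hm : ∀ i, Measurable (h i)) (hi : ∀ i, Integrable (h i) m)
    (hh : ∀ i (g : H → ℝ), IsCb1 g →
      ∫ z in Γ, divStar (A ⟨e i, he i⟩) (e i) g z ∂μ = ∫ z, g z * h i z ∂m) :
    ∫⁻ z, (∑' i, ‖h i z‖ₑ ^ 2) ^ (1 / 2 : ℝ) ∂m ≤ totalVar A μ (ind Γ) := by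
  -- For finitely many directions, the $L^1$ norm of the density vector is the limit of pairings
  -- with admissible test fields, each at most `totalVar`.
  have hfinite : ∀ s : Finset ι, ∫⁻ z, (∑ i ∈ s, ‖h i z‖ₑ ^ 2) ^ (1 / 2 : ℝ) ∂m
      ≤ totalVar A μ (ind Γ) := by
    intro s
    obtain ⟨G, hG, hG1, hlim⟩ := exists_seq_isCb1_field m s hi
    have hle : ∀ n, ∫ z, ∑ i ∈ s, G n i z * h i z ∂m ≤ (totalVar A μ (ind Γ)).toReal := by
      intro n
      have h1 : ∫ z, ∑ i ∈ s, G n i z * h i z ∂m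
          = ∫ z, gradAdjoint μ (fun z => ∑ i ∈ s, G n i z • e i) z * ind Γ z ∂μ := by
        rw [integral_mul_ind hc.measurableSet, setIntegral_gradAdjoint_sum hδ hAδ hAinv hμ s
          (fun i => ⟨e i, he i⟩) (hG n), integral_finsetSum]
        · exact Finset.sum_congr rfl fun i _ => (hh i _ (hG n i)).symm
        · intro i _
          obtain ⟨C, hC⟩ := (hG n i).2.1
          exact (hi i).bdd_mul (hG n i).continuous.measurable.aestronglyMeasurable (ae_of_all _ hC)
      have h2 : ENNReal.ofReal (∫ z, ∑ i ∈ s, G n i z * h i z ∂m) ≤ totalVar A μ (ind Γ) := by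
        rw [h1]
        refine le_iSup_of_le (fun z => ∑ i ∈ s, G n i z • e i)
          (le_iSup_of_le (isTestField_sum s (fun i => ⟨e i, he i⟩) (hG n))
            (le_iSup_of_le (fun z => ?_) le_rfl))
        have := norm_sum_smul_sq hon s fun i => G n i z
        rw [← sq_le_one_iff₀ (norm_nonneg _), this]
        exact hG1 n z
      exact (ENNReal.ofReal_le_iff_le_toReal hV.ne).1 h2
    have h3 := le_of_tendsto' hlim hle
    rw [← ENNReal.ofReal_le_iff_le_toReal hV.ne, ofReal_integral_eq_lintegral_ofReal] at h3
    · refine le_trans (le_of_eq (lintegral_congr fun z => ?_)) h3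
      rw [Real.sqrt_eq_rpow, ← ENNReal.ofReal_rpow_of_nonneg
        (Finset.sum_nonneg fun i _ => sq_nonneg _) (by norm_num),
        ENNReal.ofReal_sum_of_nonneg fun i _ => sq_nonneg _]
      congr 1
      refine Finset.sum_congr rfl fun i _ => ?_
      rw [← sq_abs, ENNReal.ofReal_pow (abs_nonneg _),
      ← Real.enorm_eq_ofReal_abs]
    · have : Measurable fun z => √(∑ i ∈ s, h i z ^ 2) :=
        (Finset.measurable_fun_sum s fun i _ => (hm i).pow_const 2).sqrt
      refine (integrable_finsetSum s fun i _ => (hi i).abs).mono this.aestronglyMeasurable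
        (ae_of_all _ fun z => ?_)
      have hnn : 0 ≤ ∑ i ∈ s, |h i z| := Finset.sum_nonneg fun i _ => abs_nonneg _
      rw [Real.norm_of_nonneg (Real.sqrt_nonneg _), Real.norm_of_nonneg hnn]
      refine Real.sqrt_le_iff.2 ⟨hnn, ?_⟩
      refine le_trans (le_of_eq (Finset.sum_congr rfl fun i _ => (sq_abs _).symm)) ?_
      exact Finset.sum_sq_le_sq_sum_of_nonneg fun i _ => abs_nonneg _
    · exact ae_of_all _ fun z => Real.sqrt_nonneg _
  -- Monotone convergence along the directed family of finite index sets removes the truncation.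
  have hsup : ∀ z, (∑' i, ‖h i z‖ₑ ^ 2) ^ (1 / 2 : ℝ)
      = ⨆ s : Finset ι, (∑ i ∈ s, ‖h i z‖ₑ ^ 2) ^ (1 / 2 : ℝ) := fun z => by
    rw [ENNReal.tsum_eq_iSup_sum]
    exact (ENNReal.orderIsoRpow (1 / 2) (by norm_num)).map_iSup _
  simp only [hsup]
  rw [lintegral_iSup_directed]
  · exact iSup_le hfinite
  · exact fun s => ((Finset.measurable_fun_sum s fun i _ => (hm i).enorm.pow_const 2).pow_const
      _).aemeasurable
  · have hmono : Monotone fun (s : Finset ι) (z : H) => (∑ i ∈ s, ‖h i z‖ₑ ^ 2) ^ (1 / 2 : ℝ) :=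
      fun s t hst z => ENNReal.rpow_le_rpow (Finset.sum_le_sum_of_subset hst) (by norm_num)
    exact hmono.directed_le

/-- The normalized opposite of a vector. -/
noncomputable def negUnit (x : H) : H := -(‖x‖⁻¹ • x)

/-- Polar decomposition of the vector measure $X\,m$. Its mass $\int|X|\,dm$ is at most `totalVar`
by the duality estimate, and at least that by the Gauss formula, as $|\langle G,\eta\rangle|\le1$
almost everywhere. -/
theorem exists_isSurfacePair (hA : IsSelfAdjoint A) (hδ : 0 < δ)
    (hAδ : ∀ x : A.domain, δ * ‖(x : H)‖ ^ 2 ≤ ⟪A x, (x : H)⟫_ℝ) (hAinv : IsBoundedInverse A Ainv)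
    (e : HilbertBasis ι ℝ H) (he : ∀ i, e i ∈ A.domain)
    {α : ι → ℝ} (hα : ∀ i, A ⟨e i, he i⟩ = α i • e i)
    (hμ : IsCenteredGaussian μ ((1 / 2 : ℝ) • Ainv))
    {Γ : Set H} (hc : IsClosed Γ) (hconv : Convex ℝ Γ) (hb : Bornology.IsBounded Γ)
    (hV : totalVar A μ (ind Γ) < ∞) :
    ∃ (σ : Measure H) (η : H → H), IsSurfacePair A μ Γ σ η := by
  have := hμ.isGaussian
  obtain ⟨m, h, hmfin, hm0, hhm, hhi, hh⟩ := exists_boundary_densities hδ hAδ hAinv hμ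
    (fun i => (⟨e i, he i⟩ : A.domain)) (fun i => e.orthonormal.ne_zero i) hc hconv hb
  have hle := lintegral_tsum_le_totalVar hδ hAδ hAinv hμ e.orthonormal he hc hV hhm hhi hh
  have hsm : Measurable fun z => ∑' i, ‖h i z‖ₑ ^ 2 :=
    Measurable.tsum fun i => (hhm i).enorm.pow_const 2
  have hfin : ∀ᵐ z ∂m, ∑' i, ‖h i z‖ₑ ^ 2 < ∞ := by
    filter_upwards [ae_lt_top (hsm.pow_const (1 / 2 : ℝ)) (hle.trans_lt hV).ne] with z hz
    exact (ENNReal.rpow_lt_top_iff_of_pos (by norm_num)).1 hz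
  obtain ⟨X, hXm, hX⟩ := exists_measurable_field e hhm hfin
  have hXn : ∀ᵐ z ∂m, (∑' i, ‖h i z‖ₑ ^ 2) ^ (1 / 2 : ℝ) = ‖X z‖ₑ := by
    filter_upwards [hX] with z hz
    simp only [← hz]
    rw [e.tsum_enorm_inner_sq, ← ENNReal.rpow_natCast, ← ENNReal.rpow_mul]
    norm_num
  rw [lintegral_congr_ae hXn] at hle
  have hXi : Integrable X m := ⟨hXm.aestronglyMeasurable, hle.trans_lt hV⟩
  have hkey : ∀ (l : A.domain) (g : H → ℝ), IsCb1 g →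
      ∫ z in Γ, divStar (A l) l g z ∂μ = ∫ z, g z * ⟪(l : H), X z⟫_ℝ ∂m := fun l g hg => by
    refine setIntegral_divStar_of_eigenbasis hA he hα hXi hg (fun i => ?_) l
    rw [hh i g hg]
    refine integral_congr_ae ?_
    filter_upwards [hX] with z hz
    rw [hz i]
  set σ : Measure H := m.withDensity fun z => ‖X z‖ₑ with hσ
  set η : H → H := fun z => negUnit (X z) with hη
  have hηm : Measurable η := by
    unfold η negUnit
    fun_prop
  have hσfin : IsFiniteMeasure σ := isFiniteMeasure_withDensity (hle.trans_lt hV).ne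
  have hσ0 : σ (frontier Γ)ᶜ = 0 := withDensity_absolutelyContinuous _ _ hm0
  have hσr : σ.restrict (frontier Γ) = σ := Measure.restrict_eq_self_of_ae_mem (mem_ae_iff.2 hσ0)
  have hη1 : ∀ᵐ z ∂σ, ‖η z‖ = 1 := by
    rw [hσ, ae_withDensity_iff hXm.enorm]
    refine ae_of_all _ fun z hz => ?_
    have : ‖X z‖ ≠ 0 := by simpa using hz
    rw [hη]
    simp only [negUnit, norm_neg, norm_smul, norm_inv, norm_norm]
    exact inv_mul_cancel₀ this
  have hgauss : ∀ G : H → H, IsTestField A G →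
      ∫ z in Γ, gradAdjoint μ G z ∂μ = - ∫ z in frontier Γ, ⟪G z, η z⟫_ℝ ∂σ := by
    rintro G ⟨n, g, l, hg, hG⟩
    have hG' : G = fun z => ∑ j, g j z • (l j : H) := funext hG
    rw [hσr, hG', setIntegral_gradAdjoint_sum hδ hAδ hAinv hμ Finset.univ l hg,
      integral_withDensity_eq_integral_toReal_smul hXm.enorm (ae_of_all _ fun z => enorm_lt_top),
      ← integral_neg]
    simp only [hkey _ _ (hg _)]
    rw [← integral_finsetSum]
    · refine integral_congr_ae (ae_of_all _ fun z => ?_)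
      simp only [hη, negUnit, inner_neg_right, inner_smul_right, toReal_enorm, smul_eq_mul, mul_neg,
        neg_neg, sum_inner, inner_smul_left]
      by_cases hz : X z = 0
      · simp [hz]
      · have : ‖X z‖ ≠ 0 := norm_ne_zero_iff.2 hz
        rw [mul_inv_cancel_left₀ this]
        simp
    · intro j _
      obtain ⟨C, hC⟩ := (hg j).2.1
      exact (hXi.const_inner (l j : H)).bdd_mul (hg j).continuous.measurable.aestronglyMeasurable
        (ae_of_all _ hC)
  have hσuniv : σ univ = ∫⁻ z, ‖X z‖ₑ ∂m := by
    rw [hσ, withDensity_apply _ MeasurableSet.univ, Measure.restrict_univ]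
  -- `Γ` is closed, so it contains its frontier, which carries all of `σ`.
  have hσΓ : σ Γ = σ univ :=
    measure_congr (eventuallyEq_univ.2 (mem_ae_iff.2 (measure_mono_null
      (compl_subset_compl.2 hc.frontier_subset) hσ0)))
  refine ⟨σ, η, hσfin, hσ0, hηm, hη1, ?_, hgauss⟩
  refine le_antisymm ?_ ?_
  · rw [hσΓ, hσuniv]; exact hle
  · rw [hσΓ]
    refine iSup_le fun G => iSup_le fun hG => iSup_le fun hG1 => ?_
    rw [integral_mul_ind hc.measurableSet, hgauss G hG, hσr]
    refine ENNReal.ofReal_le_of_le_toReal ?_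
    refine (le_abs_self _).trans ?_
    rw [abs_neg]
    have h1 : ∀ᵐ z ∂σ, ‖⟪G z, η z⟫_ℝ‖ ≤ 1 := by
      filter_upwards [hη1] with z hz
      refine (norm_inner_le_norm _ _).trans ?_
      rw [hz, mul_one]
      exact hG1 z
    have h2 := norm_integral_le_of_norm_le_const h1
    rwa [one_mul] at h2

end Existence

/-! ### Absolutely convergent double series for matrix and drift. -/

section Series

/-- On a finite measure space, a uniform almost everywhere bound on the sum of absolute values gives
integrability and the interchange of sum and integral together. -/
theorem integrable_and_hasSum_integral_of_tsum_enorm_le {X ι : Type*} [MeasurableSpace X]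
    [Countable ι] {m : Measure X} [IsFiniteMeasure m] {F : ι → X → ℝ} {f : X → ℝ} {K : ℝ≥0∞}
    (hK : K ≠ ∞) (hF : ∀ p, AEStronglyMeasurable (F p) m)
    (hb : ∀ᵐ z ∂m, ∑' p, ‖F p z‖ₑ ≤ K) (hf : ∀ᵐ z ∂m, HasSum (fun p => F p z) (f z)) :
    Integrable f m ∧ (∀ p, Integrable (F p) m) ∧ HasSum (fun p => ∫ z, F p z ∂m) (∫ z, f z ∂m) := by
  have hfm : AEStronglyMeasurable f m :=
    aestronglyMeasurable_of_tendsto_ae (atTop : Filter (Finset ι))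
      (f := fun s z => ∑ p ∈ s, F p z)
      (fun s => Finset.aestronglyMeasurable_fun_sum s fun p _ => hF p) hf
  have hfb : ∀ᵐ z ∂m, ‖f z‖ ≤ K.toReal := by
    filter_upwards [hb, hf] with z h1 h2
    rw [← h2.tsum_eq, ← toReal_enorm]
    exact ENNReal.toReal_mono hK (enorm_tsum_le_tsum_enorm.trans h1)
  have hFb : ∀ p, ∀ᵐ z ∂m, ‖F p z‖ ≤ K.toReal := fun p => by
    filter_upwards [hb] with z h1
    rw [← toReal_enorm]
    exact ENNReal.toReal_mono hK ((ENNReal.le_tsum p).trans h1)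
  have hFi : ∀ p, Integrable (F p) m := fun p => Integrable.of_bound (hF p) K.toReal (hFb p)
  refine ⟨Integrable.of_bound hfm K.toReal hfb, hFi, ?_⟩
  have hs : ∑' p, ∫⁻ z, ‖F p z‖ₑ ∂m ≠ ∞ := by
    rw [← lintegral_tsum fun p => (hF p).enorm]
    refine ne_of_lt ((lintegral_mono_ae hb).trans_lt ?_)
    rw [lintegral_const]
    exact ENNReal.mul_lt_top hK.lt_top (measure_lt_top _ _)
  have hs' : Summable fun p => ∫ z, ‖F p z‖ ∂m := by
    refine (ENNReal.summable_toReal hs).congr fun p => ?_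
    rw [integral_norm_eq_lintegral_enorm (hF p)]
  have h3 := hasSum_integral_of_summable_integral_norm hFi hs'
  have h4 : ∫ z, ∑' p, F p z ∂m = ∫ z, f z ∂m := by
    refine integral_congr_ae ?_
    filter_upwards [hf] with z hz using hz.tsum_eq
  rwa [h4] at h3

theorem ENNReal.mul_le_sq_add_sq (a b : ℝ≥0∞) : a * b ≤ a ^ 2 + b ^ 2 := by
  rcases le_total a b with h | h
  · exact (mul_le_mul_left h b).trans ((sq b).symm.le.trans le_add_self)
  · exact (mul_le_mul_right h a).trans ((sq a).symm.le.trans le_self_add)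

variable {H : Type*} [NormedAddCommGroup H] [InnerProductSpace ℝ H] [CompleteSpace H] {ι : Type*}

theorem frobeniusNorm_sq (e : HilbertBasis ι ℝ H) (T : H →L[ℝ] H) :
    ∑' i, ∑' j, ‖⟪e i, T (e j)⟫_ℝ‖ₑ ^ 2 = frobeniusNorm e T ^ 2 := by
  rw [frobeniusNorm, ← ENNReal.rpow_natCast, ← ENNReal.rpow_mul]
  norm_num

/-- The summands of the expansion of `⟨T x, y⟩` in the matrix entries of `T`. -/
noncomputable def matrixTerm (e : HilbertBasis ι ℝ H) (T : H →L[ℝ] H) (x y : H) (p : ι × ι) : ℝ :=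
  ⟪x, e p.1⟫_ℝ * (⟪e p.2, T (e p.1)⟫_ℝ * ⟪e p.2, y⟫_ℝ)

variable [Countable ι] [SecondCountableTopology H] [MeasurableSpace H] [BorelSpace H]

theorem tsum_enorm_matrixTerm_le (e : HilbertBasis ι ℝ H) (T : H →L[ℝ] H) (x y : H) :
    ∑' p, ‖matrixTerm e T x y p‖ₑ ≤ frobeniusNorm e T ^ 2 + ‖x‖ₑ ^ 2 * ‖y‖ₑ ^ 2 := by
  calc ∑' p, ‖matrixTerm e T x y p‖ₑ
      ≤ ∑' p : ι × ι, (‖⟪e p.2, T (e p.1)⟫_ℝ‖ₑ ^ 2 + ‖⟪e p.1, x⟫_ℝ‖ₑ ^ 2 * ‖⟪e p.2, y⟫_ℝ‖ₑ ^ 2) := by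
        refine ENNReal.tsum_le_tsum fun p => ?_
        have : ‖matrixTerm e T x y p‖ₑ
            = ‖⟪e p.2, T (e p.1)⟫_ℝ‖ₑ * (‖⟪e p.1, x⟫_ℝ‖ₑ * ‖⟪e p.2, y⟫_ℝ‖ₑ) := by
          rw [matrixTerm, enorm_mul, enorm_mul, real_inner_comm x (e p.1)]
          ring
        rw [this, ← mul_pow]
        exact ENNReal.mul_le_sq_add_sq _ _
    _ = frobeniusNorm e T ^ 2 + ‖x‖ₑ ^ 2 * ‖y‖ₑ ^ 2 := by
        -- Pairs are ordered as (column, row), whereas `frobeniusNorm` sums rows outside; hence the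
        -- exchange of sums.
        rw [ENNReal.tsum_add, ENNReal.tsum_prod (f := fun j i => ‖⟪e i, T (e j)⟫_ℝ‖ₑ ^ 2),
          ENNReal.tsum_comm, frobeniusNorm_sq,
          ENNReal.tsum_prod (f := fun j i => ‖⟪e j, x⟫_ℝ‖ₑ ^ 2 * ‖⟪e i, y⟫_ℝ‖ₑ ^ 2)]
        simp only [ENNReal.tsum_mul_left, ENNReal.tsum_mul_right, e.tsum_enorm_inner_sq]

/-- Absolute convergence permits summing each column first: Parseval for $Te_j$ and $y$, then for
$x$ and $T^*y$. -/
theorem hasSum_matrixTerm (e : HilbertBasis ι ℝ H) {T : H →L[ℝ] H} (hT : frobeniusNorm e T < ∞)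
    (x y : H) : HasSum (matrixTerm e T x y) ⟪T x, y⟫_ℝ := by
  have hs : Summable (matrixTerm e T x y) := by
    refine Summable.of_enorm (ne_of_lt ((tsum_enorm_matrixTerm_le e T x y).trans_lt ?_))
    exact ENNReal.add_lt_top.2 ⟨ENNReal.pow_lt_top hT, ENNReal.mul_lt_top
      (ENNReal.pow_lt_top enorm_lt_top) (ENNReal.pow_lt_top enorm_lt_top)⟩
  have h1 : ∀ j, HasSum (fun i => matrixTerm e T x y (j, i)) (⟪x, e j⟫_ℝ * ⟪T (e j), y⟫_ℝ) := fun j => by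
    have := (e.hasSum_inner_mul_inner (T (e j)) y).mul_left ⟪x, e j⟫_ℝ
    simpa only [matrixTerm, real_inner_comm] using this
  have h2 := hs.hasSum.prod_fiberwise h1
  have h3 := e.hasSum_inner_mul_inner x (ContinuousLinearMap.adjoint T y)
  simp only [ContinuousLinearMap.adjoint_inner_right] at h3
  rw [h3.unique h2]
  exact hs.hasSum

/-- The scalar product with a vector given by a double series of coefficients. -/
theorem hasSum_inner_tsum (e : HilbertBasis ι ℝ H) {d : ι → ι → ℝ}
    (hd : ∑' j, (∑' i, ‖d i j‖ₑ) ^ 2 < ∞) (x : H) :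
    ∑' p : ι × ι, ‖⟪x, e p.1⟫_ℝ * d p.2 p.1‖ₑ ≤ ‖x‖ₑ ^ 2 + ∑' j, (∑' i, ‖d i j‖ₑ) ^ 2 ∧
    HasSum (fun p : ι × ι => ⟪x, e p.1⟫_ℝ * d p.2 p.1) ⟪x, ∑' j, (∑' i, d i j) • e j⟫_ℝ := by
  have hle : ∑' p : ι × ι, ‖⟪x, e p.1⟫_ℝ * d p.2 p.1‖ₑ
      ≤ ‖x‖ₑ ^ 2 + ∑' j, (∑' i, ‖d i j‖ₑ) ^ 2 := by
    rw [ENNReal.tsum_prod (f := fun j i => ‖⟪x, e j⟫_ℝ * d i j‖ₑ), ← e.tsum_enorm_inner_sq x,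
      ← ENNReal.tsum_add]
    refine ENNReal.tsum_le_tsum fun j => ?_
    simp only [enorm_mul, ENNReal.tsum_mul_left, real_inner_comm x]
    exact ENNReal.mul_le_sq_add_sq _ _
  refine ⟨hle, ?_⟩
  have hs : Summable fun p : ι × ι => ⟪x, e p.1⟫_ℝ * d p.2 p.1 :=
    Summable.of_enorm (ne_of_lt (hle.trans_lt
      (ENNReal.add_lt_top.2 ⟨ENNReal.pow_lt_top enorm_lt_top, hd⟩)))
  have hcol : ∀ j, ∑' i, ‖d i j‖ₑ ≠ ∞ := fun j hj => by
    have := (ENNReal.le_tsum (f := fun j => (∑' i, ‖d i j‖ₑ) ^ 2) j).trans_lt hd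
    simp [hj] at this
  have h1 : ∀ j, HasSum (fun i => ⟪x, e j⟫_ℝ * d i j) (⟪x, e j⟫_ℝ * ∑' i, d i j) := fun j =>
    (Summable.of_enorm (hcol j)).hasSum.mul_left _
  have h2 := hs.hasSum.prod_fiberwise h1
  have hD : ∑' j, ‖∑' i, d i j‖ₑ ^ 2 < ∞ := by
    refine lt_of_le_of_lt (ENNReal.tsum_le_tsum fun j => ?_) hd
    gcongr
    exact enorm_tsum_le_tsum_enorm
  have h3 := e.hasSum_repr_symm ⟨fun j => ∑' i, d i j, memℓp_two_of_tsum_enorm_sq hD⟩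
  simp only at h3
  have h4 := e.hasSum_inner_mul_inner x
    (e.repr.symm ⟨fun j => ∑' i, d i j, memℓp_two_of_tsum_enorm_sq hD⟩)
  simp only [← e.repr_apply_apply, LinearIsometryEquiv.apply_symm_apply] at h4
  rw [h3.tsum_eq, h4.unique h2]
  exact hs.hasSum

end Series

/-! ### Gradients computed from extensions. -/

section GradientOnConvex

variable {H : Type*} [NormedAddCommGroup H] [InnerProductSpace ℝ H] [CompleteSpace H]
  [SecondCountableTopology H] [MeasurableSpace H] [BorelSpace H]
  {A : H →ₗ.[ℝ] H} {δ : ℝ} {Ainv : H →L[ℝ] H} {μ : Measure H} {ι : Type*} [Countable ι]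

/-- Almost everywhere on a closed convex set the gradient does not depend on the extension. -/
theorem gradOn_ae_eq (hδ : 0 < δ)
    (hAδ : ∀ x : A.domain, δ * ‖(x : H)‖ ^ 2 ≤ ⟪A x, (x : H)⟫_ℝ) (hAinv : IsBoundedInverse A Ainv)
    (hμ : IsCenteredGaussian μ ((1 / 2 : ℝ) • Ainv))
    (e : HilbertBasis ι ℝ H) (he : ∀ i, e i ∈ A.domain)
    {Γ : Set H} (hc : IsClosed Γ) (hconv : Convex ℝ Γ) {f f' : H → ℝ} (hf' : IsCb1 f')
    (hff' : EqOn f f' Γ) : ∀ᵐ z ∂μ.restrict Γ, gradOn Γ f z = gradient f' z := by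
  have hex : IsCb1On Γ f := ⟨f', hf', hff'⟩
  obtain ⟨h1, h2⟩ := hex.choose_spec
  set f'' := hex.choose with hf''
  have hg : gradOn Γ f = gradient f'' := by rw [gradOn, dif_pos hex]
  have hsub : ∀ z, gradient (fun z => f'' z - f' z) z = gradient f'' z - gradient f' z := fun z => by
    simp [gradient, fderiv_fun_sub (h1.1 z) (hf'.1 z)]
  -- The difference of two extensions vanishes on `Γ`, so its derivative along each basis vector
  -- vanishes almost everywhere there; countability of the basis gives the whole gradient.
  have key : ∀ i, ∀ᵐ z ∂μ, z ∈ Γ → ⟪gradient f'' z - gradient f' z, e i⟫_ℝ = 0 := fun i => by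
    obtain ⟨v, κ, hs⟩ := exists_isSlicing_of_mem_domain hδ hAδ hAinv hμ ⟨e i, he i⟩
      (e.orthonormal.ne_zero i)
    have := hs.inner_gradient_eq_zero hc hconv (h1.sub hf') fun z hz => by
      rw [← h2 hz, ← hff' hz, sub_self]
    simpa only [hsub] using this
  rw [ae_restrict_iff' hc.measurableSet]
  filter_upwards [ae_all_iff.2 key] with z hz hzΓ
  rw [hg, ← sub_eq_zero]
  have h3 := e.hasSum_inner_mul_inner (gradient f'' z - gradient f' z)
    (gradient f'' z - gradient f' z)
  simp only [hz _ hzΓ, zero_mul] at h3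
  exact inner_self_eq_zero.1 (h3.unique hasSum_zero)

/-- The extension agrees with the linear function on an open ball containing `K`, so its gradient is
`l` at every point of `K`, including boundary points. -/
theorem exists_isCb1_inner_eq {K : Set H} (hK : Bornology.IsBounded K) (l : H) :
    ∃ u : H → ℝ, IsCb1 u ∧ EqOn (fun z => ⟪l, z⟫_ℝ) u K ∧ ∀ z ∈ K, gradient u z = l := by
  obtain ⟨R, hR⟩ := hK.subset_ball 0
  obtain ⟨u, hu, hu'⟩ := isCb1On_inner (Metric.isBounded_ball (x := (0 : H)) (r := R)) l
  refine ⟨u, hu, hu'.mono hR, fun z hz => ?_⟩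
  have h1 : u =ᶠ[𝓝 z] fun z => ⟪l, z⟫_ℝ := by
    filter_upwards [Metric.isOpen_ball.mem_nhds (hR hz)] with y hy using (hu' hy).symm
  have h2 : HasFDerivAt (fun z => ⟪l, z⟫_ℝ) (innerSL ℝ l) z := (innerSL ℝ l).hasFDerivAt
  rw [h1.gradient_eq, gradient, h2.fderiv]
  exact (InnerProductSpace.toDual ℝ H).symm_apply_apply l

end GradientOnConvex

/-! ### The divergence theorem for the matrix perturbation. -/

section Oblique

variable {H : Type*} [NormedAddCommGroup H] [InnerProductSpace ℝ H] [CompleteSpace H]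
  [SecondCountableTopology H] [MeasurableSpace H] [BorelSpace H]
  {A : H →ₗ.[ℝ] H} {δ : ℝ} {Ainv : H →L[ℝ] H} {μ : Measure H} {ι : Type*} [Countable ι]

/-- Stated for a general measure carried by `Γ` because it serves twice: in the interior with $Y=Dg$
and on the boundary with $Y=g\,\eta$. -/
theorem hasSum_integral_matrixTerm (e : HilbertBasis ι ℝ H) {Γ : Set H} {B : H → H →L[ℝ] H}
    (hfro : (⨆ z ∈ Γ, frobeniusNorm e (B z)) < ∞) {a : ι → ι → H → ℝ} (ha : ∀ i j, IsCb1 (a i j))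
    (haB : ∀ i j, EqOn (entry e B i j) (a i j) Γ) {m : Measure H} [IsFiniteMeasure m]
    (hm : ∀ᵐ z ∂m, z ∈ Γ) {Y : H → H} (hY : Measurable Y) {C : ℝ} (hC : ∀ᵐ z ∂m, ‖Y z‖ ≤ C)
    (x : H) :
    Integrable (fun z => ⟪B z x, Y z⟫_ℝ) m ∧
    (∀ p : ι × ι, Integrable (fun z => ⟪x, e p.1⟫_ℝ * (a p.2 p.1 z * ⟪e p.2, Y z⟫_ℝ)) m) ∧
    HasSum (fun p : ι × ι => ∫ z, ⟪x, e p.1⟫_ℝ * (a p.2 p.1 z * ⟪e p.2, Y z⟫_ℝ) ∂m)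
      (∫ z, ⟪B z x, Y z⟫_ℝ ∂m) := by
  have hM : ∀ z ∈ Γ, frobeniusNorm e (B z) ≤ ⨆ z ∈ Γ, frobeniusNorm e (B z) := fun z hz =>
    le_iSup₂ (f := fun z (_ : z ∈ Γ) => frobeniusNorm e (B z)) z hz
  have heq : ∀ z ∈ Γ, ∀ p : ι × ι, ⟪x, e p.1⟫_ℝ * (a p.2 p.1 z * ⟪e p.2, Y z⟫_ℝ)
      = matrixTerm e (B z) x (Y z) p := fun z hz p => by
    rw [matrixTerm, ← haB p.2 p.1 hz, entry]
  refine integrable_and_hasSum_integral_of_tsum_enorm_le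
    (K := (⨆ z ∈ Γ, frobeniusNorm e (B z)) ^ 2 + ‖x‖ₑ ^ 2 * ENNReal.ofReal C ^ 2) ?_ ?_ ?_ ?_
  · exact (ENNReal.add_lt_top.2 ⟨ENNReal.pow_lt_top hfro, ENNReal.mul_lt_top
      (ENNReal.pow_lt_top enorm_lt_top) (ENNReal.pow_lt_top ENNReal.ofReal_lt_top)⟩).ne
  · intro p
    have h1 := (ha p.2 p.1).continuous.measurable
    have h2 : Measurable fun z => ⟪e p.2, Y z⟫_ℝ := (innerSL ℝ (e p.2)).continuous.measurable.comp hY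
    exact ((h1.mul h2).const_mul _).aestronglyMeasurable
  · filter_upwards [hm, hC] with z hz hzC
    simp only [heq z hz]
    refine (tsum_enorm_matrixTerm_le e (B z) x (Y z)).trans ?_
    have : ‖Y z‖ₑ ≤ ENNReal.ofReal C := by
      rw [← ofReal_norm]; exact ENNReal.ofReal_le_ofReal hzC
    gcongr
    exact hM z hz
  · filter_upwards [hm] with z hz
    simp only [heq z hz]
    exact hasSum_matrixTerm e ((hM z hz).trans_lt hfro) x (Y z)

/-- The summand of the drift, computed from an extension `a` of a matrix entry. -/
noncomputable def driftOf (k x : H) (a : H → ℝ) (z : H) : ℝ :=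
  a z / 2 * (-2 * ⟪k, z⟫_ℝ) + ⟪gradient a z, x⟫_ℝ / 2

theorem driftTerm_ae_eq (hδ : 0 < δ)
    (hAδ : ∀ x : A.domain, δ * ‖(x : H)‖ ^ 2 ≤ ⟪A x, (x : H)⟫_ℝ) (hAinv : IsBoundedInverse A Ainv)
    (hμ : IsCenteredGaussian μ ((1 / 2 : ℝ) • Ainv))
    (e : HilbertBasis ι ℝ H) (he : ∀ i, e i ∈ A.domain)
    {Γ : Set H} (hc : IsClosed Γ) (hconv : Convex ℝ Γ) {B : H → H →L[ℝ] H}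
    {a : ι → ι → H → ℝ} (ha : ∀ i j, IsCb1 (a i j)) (haB : ∀ i j, EqOn (entry e B i j) (a i j) Γ) :
    ∀ᵐ z ∂μ.restrict Γ, ∀ i j, driftTerm A e he Γ B i j z
      = driftOf (A ⟨e i, he i⟩) (e i) (a i j) z := by
  refine ae_all_iff.2 fun i => ae_all_iff.2 fun j => ?_
  filter_upwards [gradOn_ae_eq hδ hAδ hAinv hμ e he hc hconv (ha i j) (haB i j),
    ae_restrict_mem hc.measurableSet] with z hz hzΓ
  rw [driftTerm, hz, haB i j hzΓ, logDerivGauss, driftOf]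

theorem hasSum_integral_drift (hδ : 0 < δ)
    (hAδ : ∀ x : A.domain, δ * ‖(x : H)‖ ^ 2 ≤ ⟪A x, (x : H)⟫_ℝ) (hAinv : IsBoundedInverse A Ainv)
    (hμ : IsCenteredGaussian μ ((1 / 2 : ℝ) • Ainv))
    (e : HilbertBasis ι ℝ H) (he : ∀ i, e i ∈ A.domain)
    {Γ : Set H} (hc : IsClosed Γ) (hconv : Convex ℝ Γ) {B : H → H →L[ℝ] H}
    {a : ι → ι → H → ℝ} (ha : ∀ i j, IsCb1 (a i j)) (haB : ∀ i j, EqOn (entry e B i j) (a i j) Γ)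
    (hβ : essSup (fun z => ∑' j, (∑' i, ‖driftTerm A e he Γ B i j z‖ₑ) ^ 2) (μ.restrict Γ) < ∞)
    {g : H → ℝ} (hg : IsCb1 g) (x : H) :
    IntegrableOn (fun z => g z * ⟪x, drift A e he Γ B z⟫_ℝ) Γ μ ∧
    (∀ p : ι × ι, IntegrableOn (fun z => g z *
      (⟪x, e p.1⟫_ℝ * driftOf (A ⟨e p.2, he p.2⟩) (e p.2) (a p.2 p.1) z)) Γ μ) ∧
    HasSum (fun p : ι × ι => ∫ z in Γ, g z *
      (⟪x, e p.1⟫_ℝ * driftOf (A ⟨e p.2, he p.2⟩) (e p.2) (a p.2 p.1) z) ∂μ)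
      (∫ z in Γ, g z * ⟪x, drift A e he Γ B z⟫_ℝ ∂μ) := by
  have := hμ.isGaussian
  obtain ⟨C, hC⟩ := hg.2.1
  set M := essSup (fun z => ∑' j, (∑' i, ‖driftTerm A e he Γ B i j z‖ₑ) ^ 2) (μ.restrict Γ) with hM
  have hle : ∀ᵐ z ∂μ.restrict Γ, ∑' j, (∑' i, ‖driftTerm A e he Γ B i j z‖ₑ) ^ 2 ≤ M := ae_le_essSup
  have hd := driftTerm_ae_eq hδ hAδ hAinv hμ e he hc hconv ha haB
  refine integrable_and_hasSum_integral_of_tsum_enorm_le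
    (K := ENNReal.ofReal C * (‖x‖ₑ ^ 2 + M)) ?_ ?_ ?_ ?_
  · exact (ENNReal.mul_lt_top ENNReal.ofReal_lt_top (ENNReal.add_lt_top.2
      ⟨ENNReal.pow_lt_top enorm_lt_top, hβ⟩)).ne
  · intro p
    have h1 := hg.continuous.measurable
    have h2 := (ha p.2 p.1).continuous.measurable
    have h3 := measurable_gradient (a p.2 p.1)
    unfold driftOf
    exact Measurable.aestronglyMeasurable (by fun_prop)
  · filter_upwards [hle, hd] with z hz hdz
    simp only [enorm_mul (g z), ENNReal.tsum_mul_left, ← hdz]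
    have hgC : ‖g z‖ₑ ≤ ENNReal.ofReal C := by
      rw [← ofReal_norm]; exact ENNReal.ofReal_le_ofReal (hC z)
    refine mul_le_mul' hgC (((hasSum_inner_tsum e (hz.trans_lt hβ) x).1).trans ?_)
    gcongr
  · filter_upwards [hle, hd] with z hz hdz
    simp only [← hdz]
    exact (hasSum_inner_tsum e (hz.trans_lt hβ) x).2.mul_left (g z)

theorem IsSurfacePair.setIntegral_divStar (hδ : 0 < δ)
    (hAδ : ∀ x : A.domain, δ * ‖(x : H)‖ ^ 2 ≤ ⟪A x, (x : H)⟫_ℝ) (hAinv : IsBoundedInverse A Ainv)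
    (hμ : IsCenteredGaussian μ ((1 / 2 : ℝ) • Ainv)) {Γ : Set H} {σ : Measure H} {η : H → H}
    (hση : IsSurfacePair A μ Γ σ η) (l : A.domain) {g : H → ℝ} (hg : IsCb1 g) :
    ∫ z in Γ, divStar (A l) l g z ∂μ = - ∫ z in frontier Γ, g z * ⟪(l : H), η z⟫_ℝ ∂σ := by
  rw [← setIntegral_gradAdjoint_smul hδ hAδ hAinv hμ l hg, hση.gauss _ (isTestField_smul l hg)]
  simp only [inner_smul_left, conj_trivial]

/-- The divergence theorem for the perturbation by a matrix field. -/
theorem IsSurfacePair.integral_matrix (hδ : 0 < δ)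
    (hAδ : ∀ x : A.domain, δ * ‖(x : H)‖ ^ 2 ≤ ⟪A x, (x : H)⟫_ℝ) (hAinv : IsBoundedInverse A Ainv)
    (hμ : IsCenteredGaussian μ ((1 / 2 : ℝ) • Ainv))
    (e : HilbertBasis ι ℝ H) (he : ∀ i, e i ∈ A.domain)
    {Γ : Set H} (hc : IsClosed Γ) (hconv : Convex ℝ Γ) {B : H → H →L[ℝ] H}
    (hfro : (⨆ z ∈ Γ, frobeniusNorm e (B z)) < ∞) (hB1 : ∀ i j, IsCb1On Γ (entry e B i j))
    (hβ : essSup (fun z => ∑' j, (∑' i, ‖driftTerm A e he Γ B i j z‖ₑ) ^ 2) (μ.restrict Γ) < ∞)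
    {σ : Measure H} {η : H → H} (hση : IsSurfacePair A μ Γ σ η) {g : H → ℝ} (hg : IsCb1 g) (x : H) :
    IntegrableOn (fun z => ⟪B z x, gradient g z⟫_ℝ) Γ μ ∧
    IntegrableOn (fun z => g z * ⟪x, drift A e he Γ B z⟫_ℝ) Γ μ ∧
    IntegrableOn (fun z => ⟪B z x, g z • η z⟫_ℝ) (frontier Γ) σ ∧
    ∫ z in Γ, ⟪B z x, gradient g z⟫_ℝ ∂μ + 2 * ∫ z in Γ, g z * ⟪x, drift A e he Γ B z⟫_ℝ ∂μ
      = ∫ z in frontier Γ, ⟪B z x, g z • η z⟫_ℝ ∂σ := by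
  have := hμ.isGaussian
  have := hση.finite
  choose a ha haB using hB1
  obtain ⟨C, hC⟩ := hg.2.1
  obtain ⟨C', hC'⟩ := hg.exists_norm_gradient_le
  have hηm := hση.measurable
  obtain ⟨i1, j1, s1⟩ := hasSum_integral_matrixTerm e hfro ha haB (m := μ.restrict Γ)
    (ae_restrict_mem hc.measurableSet) (measurable_gradient g) (ae_of_all _ hC') x
  obtain ⟨i2, j2, s2⟩ := hasSum_integral_drift hδ hAδ hAinv hμ e he hc hconv ha haB hβ hg x
  have hgη : ∀ᵐ z ∂σ.restrict (frontier Γ), ‖g z • η z‖ ≤ C := by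
    filter_upwards [ae_restrict_of_ae hση.norm_eq_one] with z hz
    rw [norm_smul, hz, mul_one]
    exact hC z
  have hfr : ∀ᵐ z ∂σ.restrict (frontier Γ), z ∈ Γ := by
    filter_upwards [ae_restrict_mem isClosed_frontier.measurableSet] with z hz
    exact hc.frontier_subset hz
  obtain ⟨i3, -, s3⟩ := hasSum_integral_matrixTerm e hfro ha haB (m := σ.restrict (frontier Γ))
    hfr (Y := fun z => g z • η z) (hg.continuous.measurable.smul hηm) hgη x
  refine ⟨i1, i2, i3, (s1.add (s2.mul_left 2)).unique ?_⟩
  -- Termwise this is the Gauss formula for the field $a_{ij}g\,e_i$ times $\langle x,e_j\rangle$: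
  -- $-D^*(a_{ij}g\,e_i)=a_{ij}\partial_ig+g(a_{ij}\beta^\mu_{e_i}+\partial_ia_{ij})$, the last
  -- bracket being twice the drift summand.
  have key : ∀ p : ι × ι,
      ∫ z in frontier Γ, ⟪x, e p.1⟫_ℝ * (a p.2 p.1 z * ⟪e p.2, g z • η z⟫_ℝ) ∂σ
        = ∫ z in Γ, ⟪x, e p.1⟫_ℝ * (a p.2 p.1 z * ⟪e p.2, gradient g z⟫_ℝ) ∂μ
          + 2 * ∫ z in Γ, g z *
            (⟪x, e p.1⟫_ℝ * driftOf (A ⟨e p.2, he p.2⟩) (e p.2) (a p.2 p.1) z) ∂μ := by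
    intro p
    have h1 := hση.setIntegral_divStar hδ hAδ hAinv hμ ⟨e p.2, he p.2⟩ ((ha p.2 p.1).mul hg)
    have h2 : ∫ z in frontier Γ, ⟪x, e p.1⟫_ℝ * (a p.2 p.1 z * ⟪e p.2, g z • η z⟫_ℝ) ∂σ
        = ⟪x, e p.1⟫_ℝ * ∫ z in frontier Γ, a p.2 p.1 z * g z * ⟪e p.2, η z⟫_ℝ ∂σ := by
      rw [← integral_const_mul]
      refine integral_congr_ae (ae_of_all _ fun z => ?_)
      simp only [inner_smul_right]
      ring
    rw [h2, ← neg_eq_iff_eq_neg.2 h1, ← integral_const_mul 2,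
      ← integral_add (j1 p) ((j2 p).const_mul 2), ← integral_neg, ← integral_const_mul]
    refine integral_congr_ae (ae_of_all _ fun z => ?_)
    simp only [divStar, driftOf, (ha p.2 p.1).gradient_mul hg, inner_add_left, inner_smul_left,
      conj_trivial, real_inner_comm (gradient g z) (e p.2)]
    ring
  simpa only [key] using s3

end Oblique

/-! ### The proposition. -/

theorem mainTheorem7 {H : Type*} [NormedAddCommGroup H] [InnerProductSpace ℝ H]
    [CompleteSpace H] [TopologicalSpace.SeparableSpace H] [MeasurableSpace H] [BorelSpace H]
    -- the self-adjoint operator `A ≥ δ` with trace class inverse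
    (A : H →ₗ.[ℝ] H) (hA : IsSelfAdjoint A)
    (δ : ℝ) (hδ : 0 < δ) (hAδ : ∀ x : A.domain, δ * ‖(x : H)‖ ^ 2 ≤ ⟪A x, (x : H)⟫_ℝ)
    (Ainv : H →L[ℝ] H) (hAinv : IsBoundedInverse A Ainv) (htr : IsTraceClass Ainv)
    -- an orthonormal basis of eigenvectors
    {ι : Type*} [Countable ι] (e : HilbertBasis ι ℝ H) (he : ∀ i, e i ∈ A.domain)
    (α : ι → ℝ) (hα : ∀ i, A ⟨e i, he i⟩ = α i • e i)
    -- the Gaussian measure with covariance `A⁻¹ / 2`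
    (μ : Measure H) (hμ : IsCenteredGaussian μ ((1 / 2 : ℝ) • Ainv))
    -- the convex set
    (Γ : Set H) (hΓc : IsClosed Γ) (hΓconv : Convex ℝ Γ) (hΓb : Bornology.IsBounded Γ)
    (hBV : IsBV A μ (ind Γ))
    -- the antisymmetric perturbation
    (B : H → H →L[ℝ] H)
    (hfro : (⨆ z ∈ Γ, frobeniusNorm e (B z)) < ∞)
    (hanti : ∀ i j, ∀ z ∈ Γ, entry e B i j z = - entry e B j i z)
    (hB1 : ∀ i j, IsCb1On Γ (entry e B i j))
    (hβ : essSup (fun z => ∑' j, (∑' i, ‖driftTerm A e he Γ B i j z‖ₑ) ^ 2)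
      (μ.restrict Γ) < ∞) :
    (∃ (σ : Measure H) (η : H → H), IsSurfacePair A μ Γ σ η) ∧
    ∀ (σ : Measure H) (η : H → H), IsSurfacePair A μ Γ σ η →
      ∀ (l : A.domain) (g : H → ℝ), IsCb1 g →
        IsCb1On Γ (fun z => ⟪(l : H), z⟫_ℝ) ∧
        IntegrableOn (fun z => ⟪(B z + ContinuousLinearMap.id ℝ H)
          (gradOn Γ (fun y => ⟪(l : H), y⟫_ℝ) z), gradOn Γ g z⟫_ℝ) Γ μ ∧
        IntegrableOn (fun z => g z * ⟪(l : H), drift A e he Γ B z⟫_ℝ) Γ μ ∧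
        IntegrableOn (fun z => g z * ⟪A l, z⟫_ℝ) Γ μ ∧
        IntegrableOn (fun z => g z * ⟪(l : H),
          (ContinuousLinearMap.adjoint (B z) + ContinuousLinearMap.id ℝ H) (-η z)⟫_ℝ)
          (frontier Γ) σ ∧
        - form μ Γ (fun z => B z + ContinuousLinearMap.id ℝ H) (fun z => ⟪(l : H), z⟫_ℝ) g =
          ∫ z in Γ, g z * ⟪(l : H), drift A e he Γ B z⟫_ℝ ∂μ
          - ∫ z in Γ, g z * ⟪A l, z⟫_ℝ ∂μ
          + 1 / 2 * ∫ z in frontier Γ, g z * ⟪(l : H),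
              (ContinuousLinearMap.adjoint (B z) + ContinuousLinearMap.id ℝ H) (-η z)⟫_ℝ ∂σ := by
  have : SecondCountableTopology H := UniformSpace.secondCountable_of_separable H
  have := hμ.isGaussian
  refine ⟨exists_isSurfacePair hA hδ hAδ hAinv e he hα hμ hΓc hΓconv hΓb hBV.2, ?_⟩
  intro σ η hση l g hg
  have := hση.finite
  obtain ⟨C, hC⟩ := hg.2.1
  obtain ⟨C', hC'⟩ := hg.exists_norm_gradient_le
  have hgm := hg.continuous.measurable
  have hηm := hση.measurable
  have hDg := measurable_gradient g
  obtain ⟨u, hu, hul, hgu⟩ := exists_isCb1_inner_eq hΓb (l : H)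
  -- The two pieces of $\bar A$ are treated separately: `hmat` is the formula for `B`, `hgauss` that
  -- for the identity; half their sum is the claim.
  obtain ⟨i1, i2, i3, hmat⟩ := hση.integral_matrix hδ hAδ hAinv hμ e he hΓc hΓconv hfro hB1 hβ hg l
  have hgauss := hση.setIntegral_divStar hδ hAδ hAinv hμ l hg
  have hform : ∀ᵐ z ∂μ.restrict Γ, ⟪(B z + ContinuousLinearMap.id ℝ H)
      (gradOn Γ (fun y => ⟪(l : H), y⟫_ℝ) z), gradOn Γ g z⟫_ℝ
        = ⟪B z l, gradient g z⟫_ℝ + ⟪(l : H), gradient g z⟫_ℝ := by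
    filter_upwards [gradOn_ae_eq hδ hAδ hAinv hμ e he hΓc hΓconv hu hul,
      gradOn_ae_eq hδ hAδ hAinv hμ e he hΓc hΓconv hg (eqOn_refl g Γ),
      ae_restrict_mem hΓc.measurableSet] with z h1 h2 hz
    rw [h1, h2, hgu z hz, add_apply, inner_add_left, ContinuousLinearMap.id_apply]
  have hbd : ∀ z, g z * ⟪(l : H), (ContinuousLinearMap.adjoint (B z)
      + ContinuousLinearMap.id ℝ H) (-η z)⟫_ℝ
        = -(⟪B z l, g z • η z⟫_ℝ + g z * ⟪(l : H), η z⟫_ℝ) := fun z => by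
    rw [add_apply, inner_add_right, ContinuousLinearMap.adjoint_inner_right,
      ContinuousLinearMap.id_apply, inner_neg_right, inner_neg_right, inner_smul_right]
    ring
  have i4 : IntegrableOn (fun z => ⟪(l : H), gradient g z⟫_ℝ) Γ μ :=
    ((Integrable.of_bound hDg.aestronglyMeasurable C' (ae_of_all _ hC')).const_inner
      (l : H)).integrableOn
  have i5 : IntegrableOn (fun z => g z * ⟪A l, z⟫_ℝ) Γ μ :=
    (((memLp_two_inner μ (A l)).integrable (by norm_num)).bdd_mul hgm.aestronglyMeasurable
      (ae_of_all _ hC)).integrableOn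
  have i6 : IntegrableOn (fun z => g z * ⟪(l : H), η z⟫_ℝ) (frontier Γ) σ := by
    have h1 : Integrable η σ := Integrable.of_bound hηm.aestronglyMeasurable 1
      (hση.norm_eq_one.mono fun z hz => hz.le)
    exact ((h1.const_inner (l : H)).bdd_mul hgm.aestronglyMeasurable (ae_of_all _ hC)).integrableOn
  refine ⟨⟨u, hu, hul⟩, (integrable_congr hform).2 (i1.add i4), i2, i5, ?_, ?_⟩
  · simp only [hbd]
    exact (i3.add i6).neg
  · have hdiv : ∫ z in Γ, divStar (A l) l g z ∂μ
        = 2 * ∫ z in Γ, g z * ⟪A l, z⟫_ℝ ∂μ - ∫ z in Γ, ⟪(l : H), gradient g z⟫_ℝ ∂μ := by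
      rw [← integral_const_mul, ← integral_sub (i5.const_mul 2) i4]
      refine integral_congr_ae (ae_of_all _ fun z => ?_)
      simp only [divStar, real_inner_comm (l : H) (gradient g z)]
      ring
    rw [form, integral_congr_ae hform, integral_add i1 i4]
    simp only [hbd]
    rw [integral_neg, integral_add i3 i6]
    linarith
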